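/- Let $d,m\in\mathbb N$, $r>0$, $\mathscr A_r=\{z\in\mathbb C: 1-r<|z|<1+r\}$, and let $\mathbb T^d=(\mathbb R/\mathbb Z)^d$ with Haar probability measure $dx$, embedded in $\mathbb C^d$ by $x\mapsto(e^{2\pi i x_1},\dots,e^{2\pi i x_d})$. Let $Tx=x+\omega$ be an ergodic translation of $\mathbb T^d$. Let $A\in C^\omega_r(\mathbb T^d,\mathrm{Mat}_m(\mathbb R))$, i.e. $A:\mathbb T^d\to\mathrm{Mat}_m(\mathbb R)$ is a function that has a holomorphic extension to $\mathscr A_r^d$, continuous up to the boundary. For $n\ge 1$ put $$A^{(n)}(x)=A(T^{n-1}x)\cdots A(Tx)\,A(x),\qquad u_A^{(n)}(x)=\tfrac1n\log\|A^{(n)}(x)\|\in[-\infty,\infty),$$ where $\|\cdot\|$ is the Euclidean operator norm and $\log 0=-\infty$. Define $$\mathrm r(A^{(n)})=\max_{x\in\mathbb T^d}\mathrm{rank}\,A^{(n)}(x),\qquad \mathrm{rank}(A)=\lim_{n\to\infty}\mathrm r(A^{(n)}),$$ where the limit exists because $\mathrm r(A^{(n)})$ is non-increasing in $n$, and call $A$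 nilpotent if $A^{(n)}\equiv 0$ for some $n\ge1$. Then the limit $$L_1(A)=\lim_{n\to\infty}\int_{\mathbb T^d}\tfrac1n\log\|A^{(n)}(x)\|\,dx\in[-\infty,\infty)$$ (the top Lyapunov exponent) exists, and the following are equivalent: 1. $\mathrm{rank}(A)=0$; 2. $A$ is nilpotent; 3. $L_1(A)=-\infty$. Moreover, if $\mathrm{rank}(A)\ge1$, then there is a constant $C=C(A)<\infty$ such that $\|u_A^{(n)}\|_{L^2(\mathbb T^d)}\le C$ for all $n\ge1$. -/

import Mathlib

open MeasureTheory Filter Topology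
open scoped ENNReal NNReal

noncomputable section

namespace QPCocycle

/-- The open annulus of width `2r` around the unit circle in `ℂ`. -/
def annulus (r : ℝ) : Set ℂ := {z | 1 - r < ‖z‖ ∧ ‖z‖ < 1 + r}

/-- The product of `d` copies of the annulus, as a subset of `ℂ^d`. -/
def polyannulus (d : ℕ) (r : ℝ) : Set (Fin d → ℂ) := {z | ∀ i, z i ∈ annulus r}

/-- The standard embedding `x ↦ (exp (2πi x₁), …, exp (2πi x_d))` of the torus `(ℝ/ℤ)^d`
in `ℂ^d`. -/
def torusEmb {d : ℕ} (x : UnitAddTorus (Fin d)) : Fin d → ℂ :=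
  fun i => (AddCircle.toCircle (x i) : ℂ)

/-- The space `C^ω_r(𝕋^d, Mat_m(ℝ))` : matrix valued functions on the torus which have a
holomorphic extension to the product of annuli, continuous up to the boundary. -/
def analyticCocycles (d m : ℕ) (r : ℝ) :
    Set (UnitAddTorus (Fin d) → Matrix (Fin m) (Fin m) ℝ) :=
  {A | ∃ F : (Fin d → ℂ) → Matrix (Fin m) (Fin m) ℂ,
    (∀ i j, DifferentiableOn ℂ (fun z => F z i j) (polyannulus d r)) ∧
    (∀ i j, ContinuousOn (fun z => F z i j) (closure (polyannulus d r))) ∧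
    ∀ x, F (torusEmb x) = (A x).map (fun a : ℝ => (a : ℂ))}

section Cocycle

variable {d m : ℕ} (ω : UnitAddTorus (Fin d))
  (A : UnitAddTorus (Fin d) → Matrix (Fin m) (Fin m) ℝ)

/-- The iterates `A⁽ⁿ⁾(x) = A(T^{n-1}x) ⋯ A(Tx) A(x)` over the translation `T x = x + ω`. -/
def iter : ℕ → UnitAddTorus (Fin d) → Matrix (Fin m) (Fin m) ℝ
  | 0 => fun _ => 1
  | n + 1 => fun x => A (x + n • ω) * iter n x

/-- The geometric rank, `max_x rank A(x)`. -/
def geomRank : ℕ := ⨆ x, (A x).rank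

theorem bddAbove_rank : BddAbove (Set.range fun x => (A x).rank) :=
  ⟨m, by rintro _ ⟨x, rfl⟩; simpa using (A x).rank_le_width⟩

/-- The maximum in the definition of the geometric rank is attained. -/
theorem isGreatest_geomRank : IsGreatest (Set.range fun x => (A x).rank) (geomRank A) :=
  ⟨Nat.sSup_mem (Set.range_nonempty _) (bddAbove_rank A),
    fun _ h => le_csSup (bddAbove_rank A) h⟩

/-- The rank of the cocycle, `lim_n r(A⁽ⁿ⁾)`. -/
def rank : ℕ := limUnder atTop (fun n => geomRank (iter ω A n))

theorem antitone_geomRank : Antitone fun n => geomRank (iter ω A n) := by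
  refine antitone_nat_of_succ_le fun n => ciSup_le fun x => ?_
  exact (Matrix.rank_mul_le_right _ _).trans (le_ciSup (bddAbove_rank (iter ω A n)) x)

/-- The limit in the definition of the rank exists. -/
theorem tendsto_rank : Tendsto (fun n => geomRank (iter ω A n)) atTop (𝓝 (rank ω A)) :=
  tendsto_nhds_limUnder ⟨_, tendsto_atTop_ciInf (antitone_geomRank ω A) (OrderBot.bddBelow _)⟩

/-- `A` is nilpotent: `A⁽ⁿ⁾ ≡ 0` for some `n ≥ 1`. -/
def IsNilpotent : Prop := ∃ n ≥ 1, ∀ x, iter ω A n x = 0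

open scoped Matrix.Norms.L2Operator in
/-- The function `u⁽ⁿ⁾(x) = (1/n) log ‖A⁽ⁿ⁾(x)‖` with values in `[-∞, ∞)` (so `log 0 = -∞`),
where `‖·‖` is the Euclidean operator norm. -/
def logNorm (n : ℕ) (x : UnitAddTorus (Fin d)) : EReal :=
  ENNReal.log ‖iter ω A n x‖ₑ / (n : EReal)

/-- The integral `∫ f⁺ - ∫ f⁻` over the torus of an extended-real valued function; it is used
for functions bounded above, where the first term is finite. -/
def extIntegral (f : UnitAddTorus (Fin d) → EReal) : EReal :=
  ((∫⁻ x, (f x).toENNReal : ℝ≥0∞) : EReal) - ((∫⁻ x, (-f x).toENNReal : ℝ≥0∞) : EReal)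

/-- The finite scale top Lyapunov exponent `∫ (1/n) log ‖A⁽ⁿ⁾(x)‖ dx ∈ [-∞, ∞)`. -/
def finiteScaleExponent (n : ℕ) : EReal := extIntegral (logNorm ω A n)

/-- The top Lyapunov exponent `L₁(A)`, the limit of the finite scale exponents. -/
def topExponent : EReal := limUnder atTop (finiteScaleExponent ω A)

end Cocycle

end QPCocycle

end

/-!
If `A` is nilpotent, all later iterates vanish and the exponents are eventually `-∞`. Everything
else follows from the `L²` bound for cocycles of positive rank `k`: it makes the integrals of
`log ‖A⁽ⁿ⁾‖` finite and at least `-C n`, so that Fekete's lemma gives a finite limit.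

The bound rests on two facts.

* *Algebra.* Fix matrices `U` and `Z` of sizes `k × m` and `m × k` and put
  `D M = det (U M Z)` (`minorDet`). If `M` has rank at most `k`, it factors through `ℝ^k`, and
  multiplicativity of the determinant gives
  `D (P M N) * D M = D (P M) * D (M N)` (`minorDet_mul_mul`). For `N` so large that `A⁽ᴺ⁾` and
  `A⁽²ᴺ⁾` both have geometric rank `k`, this bounds `|D A⁽ᵖᴺ⁾|` from below by a constant to the
  power `-p` times the product of the values of `g = D A⁽²ᴺ⁾` along the orbit of `T^N`
  (`prod_abs_minorDet_le`). As `|D M| ≤ C ‖M‖` on the unit ball, `log⁻ ‖A⁽ⁿ⁾‖` is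
  dominated by a linear term plus a Birkhoff sum of `log⁻ |g|` (`exists_logNeg_iter_le`). The
  matrices `U` and `Z` are chosen so that the analytic function `g` is not identically zero.

* *Analysis.* If `g` extends holomorphically to a product of annuli and `g ≢ 0`, then
  `log⁻ |g| ∈ L²` (`lintegral_torus_logNeg_sq_lt_top`). The quantitative one-dimensional statement
  is that for a holomorphic function `|h| ≤ 1` on an annulus and any point `y` of the unit circle,
  `∫ (log⁻ |h|)² ≤ C (1 + log⁻ |h y|)²` with `C` depending on the annulus only. It is proved on
  small discs by dividing out the zeros near the centre one at a time, each division tripling the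
  central value, and applying Harnack's inequality to the zero-free quotient
  (`exists_eLpNorm_logNeg_le_of_three_pow`), then propagated by a chain of discs
  (`exists_lintegral_logNeg_sq_chain_le`). In several variables one variable is integrated out; the
  right-hand side is again `log⁻` of a holomorphic function in the remaining ones.

Translations preserve the measure, so Minkowski's inequality turns the domination of
`log⁻ ‖A⁽ⁿ⁾‖` into the uniform bound (`exists_eLpNorm_logNorm_le`).
-/

noncomputable section

namespace QPCocycle

/-! ### The negative part of the logarithm -/

/-- The negative part `log⁻ a = max (-log a) 0` of the logarithm, with `log⁻ 0 = ∞`. -/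
def logNeg (a : ℝ≥0∞) : ℝ≥0∞ := (-ENNReal.log a).toENNReal

theorem logNeg_anti {a b : ℝ≥0∞} (h : a ≤ b) : logNeg b ≤ logNeg a :=
  EReal.toENNReal_le_toENNReal (EReal.neg_le_neg_iff.2 (ENNReal.log_le_log h))

theorem logNeg_of_one_le {a : ℝ≥0∞} (h : 1 ≤ a) : logNeg a = 0 := by
  rw [logNeg, EReal.toENNReal_eq_zero_iff, EReal.neg_le, neg_zero]
  simpa using h

@[simp] theorem logNeg_one : logNeg 1 = 0 := logNeg_of_one_le le_rfl

@[simp] theorem logNeg_zero : logNeg 0 = ∞ := by simp [logNeg]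

theorem logNeg_ofReal {x : ℝ} (hx : 0 < x) :
    logNeg (ENNReal.ofReal x) = ENNReal.ofReal (-Real.log x) := by
  rw [logNeg, ENNReal.log_ofReal_of_pos hx, ← EReal.coe_neg, EReal.real_coe_toENNReal]

theorem logNeg_ne_top {a : ℝ≥0∞} (h : a ≠ 0) : logNeg a ≠ ∞ := by
  rw [logNeg, EReal.toENNReal_ne_top_iff, Ne, EReal.neg_eq_top_iff]
  simpa using h

theorem logNeg_mul_le (a b : ℝ≥0∞) : logNeg (a * b) ≤ logNeg a + logNeg b := by
  by_cases ha : a = 0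
  · simp [ha]
  by_cases hb : b = 0
  · simp [hb]
  rw [logNeg, ENNReal.log_mul_add, EReal.neg_add (by simp [ha]) (by simp [hb])]
  exact EReal.toENNReal_add_le

theorem logNeg_pow_le (a : ℝ≥0∞) (n : ℕ) : logNeg (a ^ n) ≤ n * logNeg a := by
  induction n with
  | zero => simp
  | succ n ih =>
    rw [pow_succ, Nat.cast_succ, add_mul, one_mul]
    exact (logNeg_mul_le _ _).trans (by gcongr)

theorem logNeg_prod_le {ι : Type*} (s : Finset ι) (f : ι → ℝ≥0∞) :
    logNeg (∏ i ∈ s, f i) ≤ ∑ i ∈ s, logNeg (f i) := by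
  classical
  induction s using Finset.induction_on with
  | empty => simp
  | insert i s hi ih =>
    rw [Finset.prod_insert hi, Finset.sum_insert hi]
    exact (logNeg_mul_le _ _).trans (by gcongr)

theorem measurable_logNeg : Measurable logNeg :=
  (ENNReal.log_monotone.measurable.neg).ereal_toENNReal

/-- The square of the `L²` norm as an integral. -/
theorem eLpNorm_two_sq {α : Type*} [MeasurableSpace α] (μ : Measure α) (f : α → ℝ≥0∞) :
    eLpNorm f 2 μ ^ 2 = ∫⁻ x, f x ^ 2 ∂μ := by
  rw [eLpNorm_eq_lintegral_rpow_enorm_toReal (by simp) (by simp)]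
  simp only [ENNReal.toReal_ofNat, one_div, enorm_eq_self]
  rw [← ENNReal.rpow_natCast, ← ENNReal.rpow_mul]
  simp

/-! ### Holomorphic functions on a disc -/

open Metric in
/-- A zero-free holomorphic function on a disc is the exponential of a holomorphic function. -/
theorem exists_log_on_ball {f : ℂ → ℂ} {c : ℂ} {R : ℝ} (hR : 0 < R)
    (hf : DifferentiableOn ℂ f (ball c R)) (h0 : ∀ z ∈ ball c R, f z ≠ 0) :
    ∃ h : ℂ → ℂ, DifferentiableOn ℂ h (ball c R) ∧ ∀ z ∈ ball c R, f z = Complex.exp (h z) := by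
  have hc : c ∈ ball c R := mem_ball_self hR
  have hd : DifferentiableOn ℂ (fun z => deriv f z / f z) (ball c R) :=
    (hf.deriv isOpen_ball).div hf h0
  obtain ⟨h, hhc, hh⟩ := hd.isExactOn_ball.with_val_at c (Complex.log (f c))
  refine ⟨h, fun z hz => (hh z hz).differentiableAt.differentiableWithinAt, fun z hz => ?_⟩
  have key : ∀ w ∈ ball c R, HasDerivAt (fun z => f z * Complex.exp (-h z)) 0 w := by
    intro w hw
    have h1 : HasDerivAt f (deriv f w) w :=
      (hf.differentiableAt (isOpen_ball.mem_nhds hw)).hasDerivAt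
    refine (h1.mul (hh w hw).neg.cexp).congr_deriv ?_
    field_simp [h0 w hw]
    ring
  have := isOpen_ball.is_const_of_deriv_eq_zero (convex_ball c R).isPreconnected
    (fun w hw => (key w hw).differentiableAt.differentiableWithinAt)
    (fun w hw => (key w hw).deriv) hz hc
  simp only [hhc, Complex.exp_neg, Complex.exp_log (h0 c hc)] at this
  rw [mul_inv_cancel₀ (h0 c hc)] at this
  field_simp at this
  exact this

open Metric in
/-- Harnack's inequality for `-log ‖f‖`, where `f` is zero-free and bounded by `1` on a disc, up to
an additive constant. It is the Borel–Carathéodory inequality for a logarithm `h` of `f`. -/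
theorem neg_log_norm_le_of_zero_free {f : ℂ → ℂ} {c : ℂ} {R : ℝ} (hR : 0 < R)
    (hf : DifferentiableOn ℂ f (ball c R)) (h0 : ∀ z ∈ ball c R, f z ≠ 0)
    (h1 : ∀ z ∈ ball c R, ‖f z‖ ≤ 1) {z : ℂ} (hz : z ∈ closedBall c (R / 2)) :
    -Real.log ‖f z‖ ≤ 3 * -Real.log ‖f c‖ + 2 := by
  obtain ⟨h, hd, hh⟩ := exists_log_on_ball hR hf h0
  have hlog : ∀ w ∈ ball c R, Real.log ‖f w‖ = (h w).re := fun w hw => by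
    rw [hh w hw, Complex.norm_exp, Real.log_exp]
  have hre : ∀ w ∈ ball c R, (h w).re ≤ 0 := fun w hw => by
    rw [← hlog w hw]; exact Real.log_nonpos (norm_nonneg _) (h1 w hw)
  have hc : c ∈ ball c R := mem_ball_self hR
  have hzb : z ∈ ball c R := closedBall_subset_ball (by linarith) hz
  have hmap : Set.MapsTo (fun w => c + w) (ball 0 R) (ball c R) := by
    intro w hw; simpa using hw
  -- The summand `1` keeps the bound for the real part positive when `‖f c‖ = 1`.
  have hM : 0 < -(h c).re + 1 := by linarith [hre c hc]
  have hzn : ‖z - c‖ ≤ R / 2 := by simpa [dist_eq_norm] using hz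
  have hz0 : z - c ∈ ball (0 : ℂ) R := by simp; linarith
  have bc := Complex.borelCaratheodory_zero (f := fun w => h (c + w) - h c) hM
    ((hd.comp (by fun_prop) hmap).sub_const _)
    (fun w hw => by
      have := hre _ (hmap hw)
      simp only [Set.mem_ofPred_eq, Complex.sub_re]
      linarith) hR hz0 (by simp)
  simp only [add_sub_cancel] at bc
  have h2 : 2 * (-(h c).re + 1) * ‖z - c‖ / (R - ‖z - c‖) ≤ 2 * (-(h c).re + 1) := by
    rw [div_le_iff₀ (by linarith)]
    gcongr
    linarith
  have h3 := (Complex.abs_re_le_norm (h z - h c)).trans (bc.trans h2)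
  rw [Complex.sub_re, abs_le] at h3
  rw [hlog z hzb, hlog c hc]
  linarith [h3.1]

open Metric in
/-- Dividing a function bounded by `1` on a disc by a zero close to the centre: with the
normalisation `3R/4` the quotient is still bounded by `1`, while its value at the centre is at
least `3` times larger. -/
theorem exists_divide_zero {f : ℂ → ℂ} {c a : ℂ} {R : ℝ} (hR : 0 < R) {U : Set ℂ} (hU : IsOpen U)
    (hRU : closedBall c R ⊆ U) (hf : DifferentiableOn ℂ f U)
    (h1 : ∀ z ∈ closedBall c R, ‖f z‖ ≤ 1) (ha : a ∈ closedBall c (R / 4)) (hfa : f a = 0) :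
    ∃ g : ℂ → ℂ, DifferentiableOn ℂ g U ∧ (∀ z ∈ closedBall c R, ‖g z‖ ≤ 1) ∧
      (∀ z, f z = (z - a) / (3 * R / 4 : ℝ) * g z) ∧ 3 * ‖f c‖ ≤ ‖g c‖ := by
  have haU : U ∈ 𝓝 a := hU.mem_nhds (hRU (closedBall_subset_closedBall (by linarith) ha))
  have hR4 : (0 : ℝ) < 3 * R / 4 := by linarith
  have hac : ‖a - c‖ ≤ R / 4 := by simpa [dist_eq_norm] using ha
  have hR4' : ((3 * R / 4 : ℝ) : ℂ) ≠ 0 := by exact_mod_cast hR4.ne'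
  set g : ℂ → ℂ := fun z => ((3 * R / 4 : ℝ) : ℂ) * dslope f a z with hg
  have hgd : DifferentiableOn ℂ g U :=
    ((Complex.differentiableOn_dslope haU).2 hf).const_mul _
  have hfac : ∀ z, f z = (z - a) / (3 * R / 4 : ℝ) * g z := by
    intro z
    have := sub_smul_dslope f a z
    rw [hfa, sub_zero, smul_eq_mul] at this
    rw [← this, hg]
    field_simp
  have hnorm : ∀ z, ‖f z‖ = ‖z - a‖ / (3 * R / 4) * ‖g z‖ := by
    intro z
    rw [hfac z, norm_mul, norm_div, Complex.norm_real, Real.norm_of_nonneg hR4.le]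
  refine ⟨g, hgd, ?_, hfac, ?_⟩
  · intro z hz
    have hcl : closure (ball c R) = closedBall c R := closure_ball c hR.ne'
    refine Complex.norm_le_of_forall_mem_frontier_norm_le isBounded_ball (U := ball c R)
      ⟨hgd.mono (ball_subset_closedBall.trans hRU), ?_⟩ ?_ (by rwa [hcl])
    · rw [hcl]; exact (hgd.mono hRU).continuousOn
    · intro w hw
      rw [frontier_ball c hR.ne'] at hw
      have hw' : ‖w - c‖ = R := by simpa [dist_eq_norm] using hw
      have h2 : 3 * R / 4 ≤ ‖w - a‖ := by
        have : ‖w - c‖ ≤ ‖w - a‖ + ‖a - c‖ := norm_sub_le_norm_sub_add_norm_sub w a c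
        linarith
      have h3 := h1 w (sphere_subset_closedBall hw)
      rw [hnorm w] at h3
      have h4 : 1 ≤ ‖w - a‖ / (3 * R / 4) := by rwa [le_div_iff₀ hR4, one_mul]
      nlinarith [norm_nonneg (g w)]
  · have h2 : ‖c - a‖ / (3 * R / 4) ≤ 1 / 3 := by
      rw [norm_sub_rev, div_le_iff₀ hR4]; linarith
    rw [hnorm c]
    nlinarith [norm_nonneg (g c)]

/-- `log⁻ (|t| / b)²` is integrable over bounded intervals. -/
theorem lintegral_logNeg_sq_lt_top {b : ℝ} (hb : 0 < b) :
    ∫⁻ t in Set.Ioo (-b) b, logNeg (ENNReal.ofReal (|t| / b)) ^ 2 < ∞ := by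
  have hloc : LocallyIntegrable
      (fun t : ℝ => (if t ∈ Set.Ioo (-b) b then Real.log (|t| / b) ^ 2 else 0)) volume := by
    -- `|log x| ≤ 4 x^(-1/4)` on `(0, 1]`, so the square is dominated by an integrable power.
    refine locallyIntegrable_of_norm_le_rpow (C := 16 * b ^ (1 / 2 : ℝ)) (α := 1 / 2) (by simp)
      (by norm_num) ?_ ?_
    · have : ∀ᵐ t : ℝ, t ≠ 0 := by simp [ae_iff]
      filter_upwards [this] with t ht
      have ht' : 0 < |t| := abs_pos.2 ht
      split_ifs with h
      · have hx : 0 < |t| / b := by positivity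
        have hx1 : |t| / b ≤ 1 := by
          rw [div_le_one hb]; exact (abs_lt.2 ⟨h.1, h.2⟩).le
        have h4 := (Real.abs_log_mul_self_rpow_lt _ (1 / 4) hx hx1 (by norm_num)).le
        have h5 : (Real.log (|t| / b) * (|t| / b) ^ (1 / 4 : ℝ)) ^ 2 ≤ 4 ^ 2 := by
          rw [← sq_abs]
          gcongr
          simpa using h4
        rw [mul_pow, ← Real.rpow_natCast ((|t| / b) ^ (1 / 4 : ℝ)), ← Real.rpow_mul hx.le] at h5
        norm_num at h5
        rw [Real.div_rpow ht'.le hb.le, ← le_div_iff₀ (by positivity)] at h5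
        rw [Real.norm_of_nonneg (by positivity), Real.norm_eq_abs, Real.rpow_neg ht'.le]
        refine h5.trans (le_of_eq ?_)
        rw [div_div_eq_mul_div]
        rfl
      · simp only [norm_zero]; positivity
    · refine Measurable.aestronglyMeasurable (Measurable.ite measurableSet_Ioo ?_ measurable_const)
      fun_prop
  have hint := (hloc.integrableOn_isCompact (isCompact_Icc (a := -b) (b := b))).mono_set
    Set.Ioo_subset_Icc_self
  refine lt_of_le_of_lt (setLIntegral_mono_ae' measurableSet_Ioo ?_) hint.lintegral_lt_top
  have : ∀ᵐ t : ℝ, t ≠ 0 := by simp [ae_iff]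
  filter_upwards [this] with t ht h
  have ht' : 0 < |t| := abs_pos.2 ht
  have hx1 : |t| / b ≤ 1 := by
    rw [div_le_one hb]; exact (abs_lt.2 ⟨h.1, h.2⟩).le
  rw [if_pos h, logNeg_ofReal (by positivity), ← ENNReal.ofReal_pow, neg_sq]
  exact neg_nonneg.2 (Real.log_nonpos (by positivity) hx1)

/-! ### Square integrability of the logarithm along the real line -/

theorem le_one_add_sq (x : ℝ≥0∞) : x ≤ 1 + x ^ 2 := by
  rcases le_total x 1 with h | h
  · exact h.trans le_self_add
  · calc x = x * 1 := (mul_one x).symm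
      _ ≤ x * x := by gcongr
      _ = x ^ 2 := (sq x).symm
      _ ≤ 1 + x ^ 2 := le_add_self

open Metric in
theorem exists_eLpNorm_logNeg_linear_le {R : ℝ} (hR : 0 < R) :
    ∃ K : ℝ≥0, ∀ (y : ℝ), ∀ a ∈ closedBall (y : ℂ) (R / 4),
      eLpNorm (fun t : ℝ => logNeg ‖((t : ℂ) - a) / (3 * R / 4 : ℝ)‖ₑ) 2
        (volume.restrict (Set.Ioc y (y + R / 8))) ≤ K := by
  have hb : (0 : ℝ) < 3 * R / 4 := by linarith
  set b : ℝ := 3 * R / 4 with hbdef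
  set F : ℝ → ℝ≥0∞ := (Set.Ioo (-b) b).indicator fun t => logNeg (ENNReal.ofReal (|t| / b)) ^ 2
    with hF
  have hI : ∫⁻ t, F t ≠ ∞ := by
    rw [hF, lintegral_indicator measurableSet_Ioo]
    exact (lintegral_logNeg_sq_lt_top hb).ne
  refine ⟨(1 + ∫⁻ t, F t).toNNReal, fun y a ha => ?_⟩
  rw [ENNReal.coe_toNNReal (by simp [hI])]
  refine (le_one_add_sq _).trans ?_
  rw [eLpNorm_two_sq]
  refine add_le_add le_rfl ?_
  calc ∫⁻ t in Set.Ioc y (y + R / 8), logNeg ‖((t : ℂ) - a) / (b : ℝ)‖ₑ ^ 2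
      ≤ ∫⁻ t in Set.Ioc y (y + R / 8), F (t - a.re) := by
        refine setLIntegral_mono' measurableSet_Ioc fun t ht => ?_
        have h1 : |y - a.re| ≤ R / 4 := by
          have h2 : ‖(y : ℂ) - a‖ ≤ R / 4 := by rw [← dist_eq_norm, dist_comm]; exact ha
          simpa using (Complex.abs_re_le_norm ((y : ℂ) - a)).trans h2
        rw [abs_le] at h1
        have hmem : t - a.re ∈ Set.Ioo (-b) b := by
          constructor <;> linarith [ht.1, ht.2, h1.1, h1.2]
        rw [hF, Set.indicator_of_mem hmem]
        gcongr
        apply logNeg_anti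
        rw [← ofReal_norm, norm_div, Complex.norm_real, Real.norm_of_nonneg hb.le]
        gcongr
        simpa using Complex.abs_re_le_norm ((t : ℂ) - a)
    _ ≤ ∫⁻ t, F (t - a.re) := setLIntegral_le_lintegral _ _
    _ = ∫⁻ t, F t := lintegral_sub_right_eq_self F a.re

theorem aestronglyMeasurable_logNeg {f : ℂ → ℂ} {U : Set ℂ} (hf : ContinuousOn f U) {s : Set ℝ}
    (hs : MeasurableSet s) (hsU : ∀ t ∈ s, (t : ℂ) ∈ U) :
    AEStronglyMeasurable (fun t : ℝ => logNeg ‖f t‖ₑ) (volume.restrict s) := by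
  have h1 : ContinuousOn (fun t : ℝ => f t) s :=
    hf.comp Complex.continuous_ofReal.continuousOn hsU
  exact (measurable_logNeg.comp_aemeasurable (h1.aemeasurable hs).enorm).aestronglyMeasurable

open Metric in
theorem ofReal_mem_closedBall {R y t : ℝ} (ht : t ∈ Set.Ioc y (y + R / 8)) :
    (t : ℂ) ∈ closedBall (y : ℂ) (R / 8) := by
  rw [mem_closedBall, Complex.dist_eq, ← Complex.ofReal_sub, Complex.norm_real, Real.norm_eq_abs,
    abs_le]
  constructor <;> linarith [ht.1, ht.2]

open Metric in
theorem eLpNorm_logNeg_le_of_zero_free {R : ℝ} (hR : 0 < R) {n : ℕ} {y : ℝ} {f : ℂ → ℂ}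
    (hf : DifferentiableOn ℂ f (ball (y : ℂ) (R / 4))) (h0 : ∀ z ∈ ball (y : ℂ) (R / 4), f z ≠ 0)
    (h1 : ∀ z ∈ ball (y : ℂ) (R / 4), ‖f z‖ ≤ 1) (hn : 1 ≤ 3 ^ n * ‖f y‖) :
    eLpNorm (fun t : ℝ => logNeg ‖f t‖ₑ) 2 (volume.restrict (Set.Ioc y (y + R / 8)))
      ≤ 6 * ENNReal.ofReal (R / 8) ^ (1 / (2 : ℝ≥0∞).toReal) * (n + 1) := by
  have hy : 0 < ‖f y‖ := norm_pos_iff.2 (h0 _ (mem_ball_self (by linarith)))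
  have hlog : -Real.log ‖f y‖ ≤ 2 * n := by
    have h3 : 0 ≤ Real.log (3 ^ n * ‖f y‖) := Real.log_nonneg hn
    rw [Real.log_mul (by positivity) hy.ne', Real.log_pow] at h3
    have h4 : Real.log 3 ≤ 2 := by
      have := Real.log_le_sub_one_of_pos (show (0 : ℝ) < 3 by norm_num)
      linarith
    nlinarith [(Nat.cast_nonneg n : (0 : ℝ) ≤ n)]
  have hae : ∀ᵐ t : ℝ ∂(volume.restrict (Set.Ioc y (y + R / 8))),
      ‖logNeg ‖f t‖ₑ‖ₑ ≤ ‖(6 * (n + 1) : ℝ≥0∞)‖ₑ := by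
    rw [ae_restrict_iff' measurableSet_Ioc]
    refine Eventually.of_forall fun t ht => ?_
    have hmem := ofReal_mem_closedBall ht
    have hmem' : (t : ℂ) ∈ closedBall (y : ℂ) (R / 4 / 2) := by
      rwa [div_div, show (4 * 2 : ℝ) = 8 by norm_num]
    have hb := neg_log_norm_le_of_zero_free (by linarith) hf h0 h1 hmem'
    have hpos : 0 < ‖f t‖ :=
      norm_pos_iff.2 (h0 _ (closedBall_subset_ball (by linarith) hmem))
    simp only [enorm_eq_self]
    rw [← ofReal_norm, logNeg_ofReal hpos]
    refine ENNReal.ofReal_le_of_le_toReal ?_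
    simp only [ENNReal.toReal_mul, ENNReal.toReal_ofNat]
    rw [ENNReal.toReal_add (by simp) (by simp)]
    simp only [ENNReal.toReal_natCast, ENNReal.toReal_one]
    linarith
  refine (eLpNorm_mono_enorm_ae hae).trans ?_
  rw [eLpNorm_const' _ (by simp) (by simp)]
  simp only [enorm_eq_self, Measure.restrict_apply_univ, Real.volume_Ioc, add_sub_cancel_left]
  exact le_of_eq (by ring)

open Metric in
/-- Induction on the size of `f` at the centre: as long as `f` has a zero near the centre, dividing
it out triples the central value, so that after at most `n` divisions the function is zero-free and
Harnack's inequality applies. The triangle inequality makes the bound linear in `n`. -/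
theorem exists_eLpNorm_logNeg_le_of_three_pow {R : ℝ} (hR : 0 < R) :
    ∃ K : ℝ≥0, ∀ (n : ℕ) (y : ℝ) (U : Set ℂ) (f : ℂ → ℂ), IsOpen U → closedBall (y : ℂ) R ⊆ U →
      DifferentiableOn ℂ f U → (∀ z ∈ closedBall (y : ℂ) R, ‖f z‖ ≤ 1) → 1 ≤ 3 ^ n * ‖f y‖ →
      eLpNorm (fun t : ℝ => logNeg ‖f t‖ₑ) 2 (volume.restrict (Set.Ioc y (y + R / 8)))
        ≤ K * (n + 1) := by
  obtain ⟨K, hK⟩ := exists_eLpNorm_logNeg_linear_le hR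
  set V : ℝ≥0∞ := ENNReal.ofReal (R / 8) ^ (1 / (2 : ℝ≥0∞).toReal) with hV
  have hVtop : V ≠ ∞ := by
    rw [hV]; exact ENNReal.rpow_ne_top_of_nonneg (by positivity) ENNReal.ofReal_ne_top
  refine ⟨K + 6 * V.toNNReal, fun n y U => ?_⟩
  push_cast
  rw [ENNReal.coe_toNNReal hVtop]
  induction n with
  | zero =>
    intro f hU hRU hf h1 hy
    have hy' : 1 ≤ ‖f y‖ := by simpa using hy
    have hsub : ball (y : ℂ) (R / 4) ⊆ closedBall (y : ℂ) R :=
      ball_subset_closedBall.trans (closedBall_subset_closedBall (by linarith))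
    refine (eLpNorm_logNeg_le_of_zero_free hR (hf.mono (hsub.trans hRU)) (fun a ha hfa => ?_)
      (fun z hz => h1 z (hsub hz)) hy).trans (by gcongr; exact le_add_self)
    -- A zero near the centre would give a quotient of norm at least `3` at the centre.
    obtain ⟨g, -, hg1, -, hg⟩ :=
      exists_divide_zero hR hU hRU hf h1 (ball_subset_closedBall ha) hfa
    linarith [hg1 y (mem_closedBall_self hR.le)]
  | succ n ih =>
    intro f hU hRU hf h1 hy
    have hsub : ball (y : ℂ) (R / 4) ⊆ closedBall (y : ℂ) R :=
      ball_subset_closedBall.trans (closedBall_subset_closedBall (by linarith))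
    by_cases hz : ∀ z ∈ ball (y : ℂ) (R / 4), f z ≠ 0
    · exact (eLpNorm_logNeg_le_of_zero_free hR (hf.mono (hsub.trans hRU)) hz
        (fun z hz => h1 z (hsub hz)) hy).trans (by gcongr; exact le_add_self)
    push Not at hz
    obtain ⟨a, ha, hfa⟩ := hz
    obtain ⟨g, hgd, hg1, hfac, hg⟩ :=
      exists_divide_zero hR hU hRU hf h1 (ball_subset_closedBall ha) hfa
    have hgy : 1 ≤ 3 ^ n * ‖g y‖ := by
      rw [pow_succ] at hy
      nlinarith [pow_pos (show (0 : ℝ) < 3 by norm_num) n]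
    have hsub' : ∀ t ∈ Set.Ioc y (y + R / 8), (t : ℂ) ∈ U := fun t ht =>
      hRU (closedBall_subset_closedBall (by linarith) (ofReal_mem_closedBall ht))
    have hlin : ContinuousOn (fun z : ℂ => (z - a) / (3 * R / 4 : ℝ)) U := by fun_prop
    calc eLpNorm (fun t : ℝ => logNeg ‖f t‖ₑ) 2 (volume.restrict (Set.Ioc y (y + R / 8)))
        ≤ eLpNorm ((fun t : ℝ => logNeg ‖((t : ℂ) - a) / (3 * R / 4 : ℝ)‖ₑ)
            + fun t : ℝ => logNeg ‖g t‖ₑ) 2 (volume.restrict (Set.Ioc y (y + R / 8))) := by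
          refine eLpNorm_mono_enorm fun t => ?_
          simp only [enorm_eq_self, Pi.add_apply]
          rw [hfac, enorm_mul]
          exact logNeg_mul_le _ _
      _ ≤ K + (K + 6 * V) * (n + 1) := by
          refine (eLpNorm_add_le (aestronglyMeasurable_logNeg hlin measurableSet_Ioc hsub')
            (aestronglyMeasurable_logNeg hgd.continuousOn measurableSet_Ioc hsub')
            (by simp)).trans ?_
          gcongr
          · exact hK y a (ball_subset_closedBall ha)
          · exact ih g hU hRU hgd hg1 hgy
      _ ≤ (K + 6 * V) + (K + 6 * V) * (n + 1) := by gcongr; exact le_self_add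
      _ = (K + 6 * V) * ((n + 1 : ℕ) + 1) := by push_cast; ring

/-- The open horizontal strip of half-width `ρ` around the real line. -/
def strip (ρ : ℝ) : Set ℂ := {z | |z.im| < ρ}

theorem isOpen_strip (ρ : ℝ) : IsOpen (strip ρ) :=
  isOpen_lt (by fun_prop) continuous_const

theorem ofReal_mem_strip {ρ : ℝ} (hρ : 0 < ρ) (t : ℝ) : (t : ℂ) ∈ strip ρ := by
  simpa [strip] using hρ

open Metric in
theorem closedBall_subset_strip {R ρ : ℝ} (h : R < ρ) (y : ℝ) : closedBall (y : ℂ) R ⊆ strip ρ := by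
  intro z hz
  have hz' : ‖z - y‖ ≤ R := by rw [← dist_eq_norm]; exact hz
  have := (Complex.abs_im_le_norm (z - y)).trans hz'
  simp only [Complex.sub_im, Complex.ofReal_im, sub_zero] at this
  exact this.trans_lt h

/-- The local estimate, in integral form. -/
theorem exists_lintegral_logNeg_sq_le {ρ : ℝ} (hρ : 0 < ρ) :
    ∃ C : ℝ≥0, ∀ f : ℂ → ℂ, DifferentiableOn ℂ f (strip ρ) → (∀ z ∈ strip ρ, ‖f z‖ ≤ 1) →
      ∀ y : ℝ, ∫⁻ t in Set.Ioc y (y + ρ / 16), logNeg ‖f t‖ₑ ^ 2 ≤ C * (logNeg ‖f y‖ₑ + 1) ^ 2 := by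
  obtain ⟨K, hK⟩ := exists_eLpNorm_logNeg_le_of_three_pow (R := ρ / 2) (by linarith)
  refine ⟨(2 * K + 1) ^ 2, fun f hf h1 y => ?_⟩
  by_cases hy : f y = 0
  · simp [hy, ENNReal.mul_top]
  have hpos : 0 < ‖f y‖ := norm_pos_iff.2 hy
  have hle : ‖f y‖ ≤ 1 := h1 _ (ofReal_mem_strip hρ y)
  have hlog : 0 ≤ -Real.log ‖f y‖ := neg_nonneg.2 (Real.log_nonpos hpos.le hle)
  set n := ⌈-Real.log ‖f y‖⌉₊ with hn
  have hsub := closedBall_subset_strip (R := ρ / 2) (ρ := ρ) (by linarith) y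
  have h3 : 1 ≤ 3 ^ n * ‖f y‖ := by
    have h4 : Real.exp 1 ≤ 3 := by linarith [Real.exp_one_lt_d9]
    calc (1 : ℝ) = Real.exp (-Real.log ‖f y‖) * ‖f y‖ := by
          rw [Real.exp_neg, Real.exp_log hpos, inv_mul_cancel₀ hpos.ne']
      _ ≤ Real.exp n * ‖f y‖ := by gcongr; exact Nat.le_ceil _
      _ = Real.exp 1 ^ n * ‖f y‖ := by rw [← Real.exp_nat_mul, mul_one]
      _ ≤ 3 ^ n * ‖f y‖ := by gcongr
  have key := hK n y (strip ρ) f (isOpen_strip ρ) hsub hf (fun z hz => h1 z (hsub hz)) h3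
  rw [show ρ / 2 / 8 = ρ / 16 by ring] at key
  rw [← eLpNorm_two_sq]
  have hn1 : (n : ℝ≥0∞) ≤ logNeg ‖f y‖ₑ + 1 := by
    rw [← ofReal_norm, logNeg_ofReal hpos, ← ENNReal.ofReal_one,
      ← ENNReal.ofReal_add hlog zero_le_one, ← ENNReal.ofReal_natCast]
    exact ENNReal.ofReal_le_ofReal (Nat.ceil_lt_add_one hlog).le
  calc _ ≤ ((K : ℝ≥0∞) * (n + 1)) ^ 2 := by gcongr
    _ ≤ (K * ((logNeg ‖f y‖ₑ + 1) + (logNeg ‖f y‖ₑ + 1))) ^ 2 := by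
        gcongr; exact le_add_self
    _ = (2 * K * (logNeg ‖f y‖ₑ + 1)) ^ 2 := by ring
    _ ≤ ((2 * K + 1) * (logNeg ‖f y‖ₑ + 1)) ^ 2 := by gcongr; exact le_self_add
    _ = _ := by push_cast; ring

theorem add_one_sq_le (x : ℝ≥0∞) : (x + 1) ^ 2 ≤ 2 * x ^ 2 + 2 := by
  have := ENNReal.rpow_add_le_mul_rpow_add_rpow x 1 (p := 2) (by norm_num)
  norm_num [mul_add] at this
  exact this

/-- The local estimate propagates along the real line: an interval on which it holds contains a
point where `log⁻ ‖f‖` is at most its mean value, and this point serves as the next centre. -/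
theorem exists_lintegral_logNeg_sq_chain_le {ρ : ℝ} (hρ : 0 < ρ) (k : ℕ) :
    ∃ C : ℝ≥0, ∀ f : ℂ → ℂ, DifferentiableOn ℂ f (strip ρ) → (∀ z ∈ strip ρ, ‖f z‖ ≤ 1) →
      ∀ y : ℝ, ∫⁻ t in Set.Ioc y (y + k * (ρ / 32)), logNeg ‖f t‖ₑ ^ 2
        ≤ C * (logNeg ‖f y‖ₑ + 1) ^ 2 := by
  obtain ⟨C₀, hC₀⟩ := exists_lintegral_logNeg_sq_le hρ
  have hδ : 0 < ρ / 32 := by linarith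
  set δ : ℝ := ρ / 32 with hδdef
  induction k with
  | zero => exact ⟨0, fun f _ _ y => by simp⟩
  | succ k ih =>
    obtain ⟨C, hC⟩ := ih
    set D : ℝ≥0 := (Real.toNNReal δ)⁻¹ with hD
    have hDc : (ENNReal.ofReal δ)⁻¹ = D := by
      rw [hD, ENNReal.coe_inv (by simpa using hδ)]; rfl
    refine ⟨C₀ + C * (2 * (D * C₀) + 2), fun f hf h1 y => ?_⟩
    have hmeas : AEMeasurable (fun t : ℝ => logNeg ‖f t‖ₑ ^ 2)
        (volume.restrict (Set.Ioc (y + δ) (y + 2 * δ))) :=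
      ((aestronglyMeasurable_logNeg hf.continuousOn measurableSet_Ioc
        fun t _ => ofReal_mem_strip hρ t).aemeasurable).pow_const 2
    have hvol : volume (Set.Ioc (y + δ) (y + 2 * δ)) = ENNReal.ofReal δ := by
      rw [Real.volume_Ioc]; congr 1; ring
    -- The next centre lies in the right half of the interval, so each step advances by `δ`.
    obtain ⟨y', hy', hle⟩ := exists_le_setLAverage (by rw [hvol]; simpa using hδ)
      (by rw [hvol]; exact ENNReal.ofReal_ne_top) hmeas
    have hloc := hC₀ f hf h1 y
    rw [show ρ / 16 = 2 * δ by rw [hδdef]; ring] at hloc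
    rw [setLAverage_eq, hvol, ENNReal.div_eq_inv_mul, hDc] at hle
    have hy'2 : logNeg ‖f y'‖ₑ ^ 2 ≤ D * (C₀ * (logNeg ‖f y‖ₑ + 1) ^ 2) := by
      refine hle.trans ?_
      gcongr
      refine le_trans (lintegral_mono_set (Set.Ioc_subset_Ioc_left (by linarith))) hloc
    have hnext : (logNeg ‖f y'‖ₑ + 1) ^ 2 ≤ (2 * (D * C₀) + 2) * (logNeg ‖f y‖ₑ + 1) ^ 2 := by
      have hone : (1 : ℝ≥0∞) ≤ (logNeg ‖f y‖ₑ + 1) ^ 2 := one_le_pow₀ le_add_self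
      calc _ ≤ 2 * (D * (C₀ * (logNeg ‖f y‖ₑ + 1) ^ 2)) + 2 * 1 := by
            rw [mul_one]; exact (add_one_sq_le _).trans (by gcongr)
        _ ≤ 2 * (D * (C₀ * (logNeg ‖f y‖ₑ + 1) ^ 2)) + 2 * (logNeg ‖f y‖ₑ + 1) ^ 2 := by gcongr
        _ = _ := by ring
    have hcover : Set.Ioc y (y + (k + 1 : ℕ) * δ) ⊆
        Set.Ioc y (y + 2 * δ) ∪ Set.Ioc y' (y' + k * δ) := by
      intro t ht
      rcases le_or_gt t (y + 2 * δ) with h | h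
      · exact Or.inl ⟨ht.1, h⟩
      · refine Or.inr ⟨hy'.2.trans_lt h, ht.2.trans ?_⟩
        push_cast
        linarith [hy'.1]
    calc ∫⁻ t in Set.Ioc y (y + (k + 1 : ℕ) * δ), logNeg ‖f t‖ₑ ^ 2
        ≤ (∫⁻ t in Set.Ioc y (y + 2 * δ), logNeg ‖f t‖ₑ ^ 2)
          + ∫⁻ t in Set.Ioc y' (y' + k * δ), logNeg ‖f t‖ₑ ^ 2 :=
          (lintegral_mono_set hcover).trans (lintegral_union_le _ _ _)
      _ ≤ C₀ * (logNeg ‖f y‖ₑ + 1) ^ 2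
          + C * ((2 * (D * C₀) + 2) * (logNeg ‖f y‖ₑ + 1) ^ 2) := by
          gcongr
          exact (hC f hf h1 y').trans (by gcongr)
      _ = _ := by push_cast; ring

/-! ### Holomorphic functions on a product of annuli -/

theorem toCircle_mem_annulus {r : ℝ} (hr : 0 < r) (x : UnitAddCircle) :
    (AddCircle.toCircle x : ℂ) ∈ annulus r := by
  simp only [annulus, Set.mem_ofPred_eq, Circle.norm_coe]
  constructor <;> linarith

theorem torusEmb_mem {d : ℕ} {r : ℝ} (hr : 0 < r) (x : UnitAddTorus (Fin d)) :
    torusEmb x ∈ polyannulus d r := fun i => toCircle_mem_annulus hr (x i)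

theorem continuous_torusEmb {d : ℕ} : Continuous (torusEmb (d := d)) :=
  continuous_pi fun i => continuous_subtype_val.comp
    (AddCircle.continuous_toCircle.comp (continuous_apply i))

theorem exists_exp_mem_annulus {r : ℝ} (hr : 0 < r) :
    ∃ ρ > 0, ∀ w ∈ strip ρ, Complex.exp (2 * Real.pi * Complex.I * w) ∈ annulus r := by
  have hc : Continuous fun x : ℝ => Real.exp (-(2 * Real.pi * x)) := by fun_prop
  obtain ⟨ρ, hρ, h⟩ := Metric.continuousAt_iff.1 (hc.continuousAt (x := 0)) r hr
  refine ⟨ρ, hρ, fun w hw => ?_⟩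
  have h1 := h (x := w.im) (by rw [Real.dist_eq, sub_zero]; exact hw)
  rw [Real.dist_eq, mul_zero, neg_zero, Real.exp_zero, abs_lt] at h1
  have h2 : ‖Complex.exp (2 * Real.pi * Complex.I * w)‖ = Real.exp (-(2 * Real.pi * w.im)) := by
    rw [Complex.norm_exp]
    congr 1
    simp
  simp only [annulus, Set.mem_ofPred_eq, h2]
  constructor <;> linarith [h1.1, h1.2]

/-- For a holomorphic function bounded by `1` on an annulus, the `L²` norm of `log⁻ ‖h‖` over the
unit circle is controlled by the value at any single point of the circle. -/
theorem exists_lintegral_circle_logNeg_sq_le {r : ℝ} (hr : 0 < r) :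
    ∃ C : ℝ≥0, ∀ h : ℂ → ℂ, DifferentiableOn ℂ h (annulus r) → (∀ z ∈ annulus r, ‖h z‖ ≤ 1) →
      ∀ y : UnitAddCircle, ∫⁻ x : UnitAddCircle, logNeg ‖h (AddCircle.toCircle x)‖ₑ ^ 2
        ≤ C * (logNeg ‖h (AddCircle.toCircle y)‖ₑ + 1) ^ 2 := by
  obtain ⟨ρ, hρ, hmem⟩ := exists_exp_mem_annulus hr
  obtain ⟨k, hk⟩ := exists_nat_gt (1 / (ρ / 32))
  obtain ⟨C, hC⟩ := exists_lintegral_logNeg_sq_chain_le hρ k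
  refine ⟨C, fun h hd h1 y => ?_⟩
  obtain ⟨t₀, rfl⟩ := QuotientAddGroup.mk_surjective y
  set f : ℂ → ℂ := fun w => h (Complex.exp (2 * Real.pi * Complex.I * w)) with hf
  have hft : ∀ t : ℝ, h (AddCircle.toCircle (t : UnitAddCircle)) = f t := by
    intro t
    rw [hf, AddCircle.toCircle_apply_mk, Circle.coe_exp]
    congr 2
    push_cast
    ring
  have hfd : DifferentiableOn ℂ f (strip ρ) := hd.comp (by fun_prop) hmem
  have := hC f hfd (fun w hw => h1 _ (hmem w hw)) t₀
  rw [← UnitAddCircle.lintegral_preimage t₀]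
  change ∫⁻ t : ℝ in Set.Ioc t₀ (t₀ + 1), logNeg ‖h (AddCircle.toCircle (t : UnitAddCircle))‖ₑ ^ 2
    ≤ C * (logNeg ‖h (AddCircle.toCircle (t₀ : UnitAddCircle))‖ₑ + 1) ^ 2
  simp only [hft]
  refine le_trans (lintegral_mono_set (Set.Ioc_subset_Ioc_right ?_)) this
  rw [div_lt_iff₀ (by linarith)] at hk
  linarith

theorem torusEmb_cons {d : ℕ} (a : UnitAddCircle) (b : UnitAddTorus (Fin d)) :
    torusEmb (Fin.cons a b : Fin (d + 1) → UnitAddCircle)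
      = Fin.cons (AddCircle.toCircle a : ℂ) (torusEmb b) := by
  funext i
  refine Fin.cases ?_ (fun j => ?_) i <;> simp [torusEmb]

theorem cons_mem_polyannulus {d : ℕ} {r : ℝ} {a : ℂ} {b : Fin d → ℂ} (ha : a ∈ annulus r)
    (hb : b ∈ polyannulus d r) : (Fin.cons a b : Fin (d + 1) → ℂ) ∈ polyannulus (d + 1) r := by
  intro i
  refine Fin.cases ?_ (fun j => ?_) i
  · simpa using ha
  · simpa using hb j

theorem differentiable_cons_left {d : ℕ} (b : Fin d → ℂ) :
    Differentiable ℂ fun a : ℂ => (Fin.cons a b : Fin (d + 1) → ℂ) := by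
  rw [differentiable_pi]
  refine Fin.cases ?_ (fun j => ?_)
  · simp
  · simp

theorem differentiable_cons_right {d : ℕ} (a : ℂ) :
    Differentiable ℂ fun b : Fin d → ℂ => (Fin.cons a b : Fin (d + 1) → ℂ) := by
  rw [differentiable_pi]
  refine Fin.cases ?_ (fun j => ?_)
  · simp
  · simpa using differentiable_apply (𝕜 := ℂ) j

/-- A holomorphic function on a product of annuli which does not vanish identically on the torus
has a logarithm that is square integrable on the torus. In the induction on the dimension, the
first variable is integrated out by the one-dimensional estimate, whose right-hand side is again
the logarithm of a holomorphic function in the remaining variables. -/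
theorem lintegral_torus_logNeg_sq_lt_top {r : ℝ} (hr : 0 < r) (d : ℕ) (G : (Fin d → ℂ) → ℂ)
    (hG : DifferentiableOn ℂ G (polyannulus d r)) (h1 : ∀ z ∈ polyannulus d r, ‖G z‖ ≤ 1)
    (y : UnitAddTorus (Fin d)) (hy : G (torusEmb y) ≠ 0) :
    ∫⁻ x, logNeg ‖G (torusEmb x)‖ₑ ^ 2 < ∞ := by
  induction d with
  | zero =>
    have : ∀ x : UnitAddTorus (Fin 0), logNeg ‖G (torusEmb x)‖ₑ ^ 2
        = logNeg ‖G (torusEmb y)‖ₑ ^ 2 := fun x => by rw [Subsingleton.elim x y]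
    simp only [this, lintegral_const]
    refine ENNReal.mul_lt_top ?_ (measure_lt_top _ _)
    exact ENNReal.pow_lt_top (logNeg_ne_top (by simpa using hy)).lt_top
  | succ d ih =>
    obtain ⟨C, hC⟩ := exists_lintegral_circle_logNeg_sq_le hr
    have hcont : Continuous fun x : UnitAddTorus (Fin (d + 1)) => G (torusEmb x) :=
      hG.continuousOn.comp_continuous continuous_torusEmb fun x => torusEmb_mem hr x
    have hmeas : Measurable fun x : UnitAddTorus (Fin (d + 1)) => logNeg ‖G (torusEmb x)‖ₑ ^ 2 :=
      (measurable_logNeg.comp hcont.measurable.enorm).pow_const 2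
    have hmp := (volume_preserving_piFinSuccAbove (fun _ : Fin (d + 1) => UnitAddCircle) 0).symm
    have hsymm : ∀ p : UnitAddCircle × UnitAddTorus (Fin d),
        (MeasurableEquiv.piFinSuccAbove (fun _ : Fin (d + 1) => UnitAddCircle) 0).symm p
          = Fin.cons p.1 p.2 := fun p => by
      simp [MeasurableEquiv.piFinSuccAbove]
      rfl
    obtain ⟨y₀, y', rfl⟩ : ∃ a b, y = (Fin.cons a b : Fin (d + 1) → UnitAddCircle) :=
      ⟨y 0, Fin.tail y, (Fin.cons_self_tail y).symm⟩
    have hI := ih (fun z => G (Fin.cons (AddCircle.toCircle y₀ : ℂ) z))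
      (hG.comp (differentiable_cons_right _).differentiableOn
        fun z hz => cons_mem_polyannulus (toCircle_mem_annulus hr y₀) hz)
      (fun z hz => h1 _ (cons_mem_polyannulus (toCircle_mem_annulus hr y₀) hz)) y'
      (by rwa [torusEmb_cons] at hy)
    rw [← hmp.lintegral_comp hmeas]
    have hm := (hmeas.comp hmp.measurable).aemeasurable
      (μ := (volume : Measure UnitAddCircle).prod (volume : Measure (UnitAddTorus (Fin d))))
    simp only [Function.comp_def, hsymm] at hm ⊢
    change ∫⁻ p : UnitAddCircle × UnitAddTorus (Fin d), _ ∂(volume.prod volume) < ∞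
    rw [lintegral_prod_symm _ hm]
    have hstep : ∀ b : UnitAddTorus (Fin d),
        ∫⁻ a : UnitAddCircle, logNeg ‖G (torusEmb (Fin.cons a b : Fin (d + 1) → UnitAddCircle))‖ₑ ^ 2
          ≤ C * (2 * logNeg ‖G (Fin.cons (AddCircle.toCircle y₀ : ℂ) (torusEmb b))‖ₑ ^ 2 + 2) := by
      intro b
      simp only [torusEmb_cons]
      refine (hC (fun z => G (Fin.cons z (torusEmb b)))
        (hG.comp (differentiable_cons_left _).differentiableOn
          fun z hz => cons_mem_polyannulus hz (torusEmb_mem hr b))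
        (fun z hz => h1 _ (cons_mem_polyannulus hz (torusEmb_mem hr b))) y₀).trans ?_
      gcongr
      exact add_one_sq_le _
    refine (lintegral_mono hstep).trans_lt ?_
    rw [lintegral_const_mul' _ _ ENNReal.coe_ne_top, lintegral_add_right _ measurable_const,
      lintegral_const_mul' _ _ (by simp)]
    refine ENNReal.mul_lt_top ENNReal.coe_lt_top (ENNReal.add_lt_top.2 ⟨?_, ?_⟩)
    · exact ENNReal.mul_lt_top (by simp) hI
    · rw [lintegral_const]
      exact ENNReal.mul_lt_top (by simp) (measure_lt_top _ _)

/-! ### Compression determinants of matrices of bounded rank -/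

section LinearAlgebra

variable {m k : ℕ}

/-- A rank factorisation `M = X Y` of a matrix of rank `k`, together with a two-sided compression
of `M` to the identity of size `k`. -/
theorem exists_rank_factorization (M : Matrix (Fin m) (Fin m) ℝ) :
    ∃ (X Z : Matrix (Fin m) (Fin M.rank) ℝ) (Y U : Matrix (Fin M.rank) (Fin m) ℝ),
      M = X * Y ∧ U * M * Z = 1 := by
  obtain ⟨V, W, e, hV, hW, h⟩ := M.exists_rank_normal_form
  set P : Matrix (Fin m) (Fin M.rank) ℝ :=
    (Matrix.fromRows 1 0 : Matrix (Fin M.rank ⊕ Fin (Fintype.card (Fin m) - M.rank)) _ ℝ).submatrix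
      e id with hP
  set Q : Matrix (Fin M.rank) (Fin m) ℝ :=
    (Matrix.fromCols 1 0 : Matrix _ (Fin M.rank ⊕ Fin (Fintype.card (Fin m) - M.rank)) ℝ).submatrix
      id e with hQ
  have hPQ : (Matrix.fromBlocks 1 0 0 0 : Matrix (Fin M.rank ⊕ Fin (Fintype.card (Fin m) - M.rank))
      (Fin M.rank ⊕ Fin (Fintype.card (Fin m) - M.rank)) ℝ).submatrix e e = P * Q := by
    have := Matrix.submatrix_mul_equiv
      (Matrix.fromRows 1 0 : Matrix (Fin M.rank ⊕ Fin (Fintype.card (Fin m) - M.rank)) _ ℝ)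
      (Matrix.fromCols 1 0 : Matrix _ (Fin M.rank ⊕ Fin (Fintype.card (Fin m) - M.rank)) ℝ)
      e (Equiv.refl (Fin M.rank)) e
    rw [hP, hQ]
    refine Eq.trans ?_ this.symm
    rw [Matrix.fromRows_mul_fromCols]
    simp
  have hQP : Q * P = 1 := by
    rw [hP, hQ, Matrix.submatrix_mul_equiv, Matrix.fromCols_mul_fromRows]
    simp
  have hV' : IsUnit V.det := (Matrix.isUnit_iff_isUnit_det _).1 hV
  have hW' : IsUnit W.det := (Matrix.isUnit_iff_isUnit_det _).1 hW
  rw [hPQ] at h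
  refine ⟨V⁻¹ * P, W * P, Q * W⁻¹, Q * V, ?_, ?_⟩
  · calc M = V⁻¹ * V * M * (W * W⁻¹) := by
          rw [Matrix.nonsing_inv_mul _ hV', Matrix.mul_nonsing_inv _ hW', one_mul, mul_one]
      _ = V⁻¹ * (V * M * W) * W⁻¹ := by simp only [Matrix.mul_assoc]
      _ = V⁻¹ * P * (Q * W⁻¹) := by rw [h]; simp only [Matrix.mul_assoc]
  · calc Q * V * M * (W * P) = Q * (V * M * W) * P := by simp only [Matrix.mul_assoc]
      _ = (Q * P) * (Q * P) := by rw [h]; simp only [Matrix.mul_assoc]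
      _ = 1 := by rw [hQP, one_mul]

/-- The compression determinant `det (U M Z)`, a fixed linear combination of the `k × k` minors
of `M`. -/
def minorDet (U : Matrix (Fin k) (Fin m) ℝ) (Z : Matrix (Fin m) (Fin k) ℝ)
    (M : Matrix (Fin m) (Fin m) ℝ) : ℝ := (U * M * Z).det

variable (U : Matrix (Fin k) (Fin m) ℝ) (Z : Matrix (Fin m) (Fin k) ℝ)

theorem minorDet_eq_zero_of_rank_lt {M : Matrix (Fin m) (Fin m) ℝ} (h : M.rank < k) :
    minorDet U Z M = 0 := by
  by_contra hne
  have h1 := Matrix.rank_of_isUnit (U * M * Z)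
    ((Matrix.isUnit_iff_isUnit_det _).2 (isUnit_iff_ne_zero.2 hne))
  have h2 := (Matrix.rank_mul_le_left (U * M) Z).trans (Matrix.rank_mul_le_right U M)
  rw [h1, Fintype.card_fin] at h2
  omega

/-- On matrices of rank at most `k` the compression determinant behaves like a matrix entry of
rank one matrices: a middle factor of rank at most `k` splits the product. -/
theorem minorDet_mul_mul (P M N : Matrix (Fin m) (Fin m) ℝ) (hM : M.rank ≤ k) :
    minorDet U Z (P * (M * N)) * minorDet U Z M
      = minorDet U Z (P * M) * minorDet U Z (M * N) := by
  rcases hM.lt_or_eq with h | h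
  · rw [minorDet_eq_zero_of_rank_lt U Z h,
      minorDet_eq_zero_of_rank_lt U Z ((Matrix.rank_mul_le_right P M).trans_lt h), mul_zero,
      zero_mul]
  · obtain ⟨X, Y, rfl⟩ : ∃ (X : Matrix (Fin m) (Fin k) ℝ) (Y : Matrix (Fin k) (Fin m) ℝ),
        M = X * Y := by
      subst h
      obtain ⟨X, -, Y, -, hXY, -⟩ := exists_rank_factorization M
      exact ⟨X, Y, hXY⟩
    have e1 : U * (P * (X * Y * N)) * Z = (U * P * X) * (Y * N * Z) := by
      simp only [Matrix.mul_assoc]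
    have e2 : U * (X * Y) * Z = (U * X) * (Y * Z) := by
      simp only [Matrix.mul_assoc]
    have e3 : U * (P * (X * Y)) * Z = (U * P * X) * (Y * Z) := by
      simp only [Matrix.mul_assoc]
    have e4 : U * (X * Y * N) * Z = (U * X) * (Y * N * Z) := by
      simp only [Matrix.mul_assoc]
    rw [minorDet, minorDet, minorDet, minorDet, e1, e2, e3, e4]
    simp only [Matrix.det_mul]
    ring

theorem minorDet_smul (c : ℝ) (M : Matrix (Fin m) (Fin m) ℝ) :
    minorDet U Z (c • M) = c ^ k * minorDet U Z M := by
  simp [minorDet]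

theorem continuous_minorDet : Continuous (minorDet U Z) := by
  unfold minorDet
  fun_prop

open scoped Matrix.Norms.L2Operator in
/-- By homogeneity of degree `k ≥ 1`, the compression determinant is dominated by the norm on the
unit ball. -/
theorem exists_abs_minorDet_le (hk : 1 ≤ k) :
    ∃ C : ℝ, 1 ≤ C ∧ ∀ M : Matrix (Fin m) (Fin m) ℝ, ‖M‖ ≤ 1 → |minorDet U Z M| ≤ C * ‖M‖ := by
  obtain ⟨C, hC⟩ := (isCompact_closedBall (0 : Matrix (Fin m) (Fin m) ℝ) 1).exists_bound_of_continuousOn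
    (continuous_minorDet U Z).continuousOn
  refine ⟨max C 1, le_max_right _ _, fun M hM => ?_⟩
  rcases eq_or_ne M 0 with rfl | h0
  · have := minorDet_smul U Z 0 (0 : Matrix (Fin m) (Fin m) ℝ)
    rw [zero_smul, zero_pow (by omega), zero_mul] at this
    simp [this]
  have hpos : 0 < ‖M‖ := norm_pos_iff.2 h0
  have h1 : M = ‖M‖ • (‖M‖⁻¹ • M) := by rw [smul_smul, mul_inv_cancel₀ hpos.ne', one_smul]
  have h2 := hC (‖M‖⁻¹ • M) (by
    rw [mem_closedBall_zero_iff, norm_smul, norm_inv, norm_norm, inv_mul_cancel₀ hpos.ne'])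
  rw [Real.norm_eq_abs] at h2
  calc |minorDet U Z M| = ‖M‖ ^ k * |minorDet U Z (‖M‖⁻¹ • M)| := by
        conv_lhs => rw [h1]
        rw [minorDet_smul, abs_mul, abs_of_nonneg (by positivity)]
    _ ≤ ‖M‖ ^ 1 * max C 1 := by
        exact mul_le_mul (pow_le_pow_of_le_one hpos.le hM hk) (h2.trans (le_max_left _ _))
          (abs_nonneg _) (by positivity)
    _ = max C 1 * ‖M‖ := by ring

/-- The product `M (n-1) ⋯ M 1 M 0` of the first `n` matrices of a sequence. -/
def matProd (M : ℕ → Matrix (Fin m) (Fin m) ℝ) : ℕ → Matrix (Fin m) (Fin m) ℝ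
  | 0 => 1
  | n + 1 => M n * matProd M n

/-- A product of matrices of rank at most `k` is bounded from below through the products of
consecutive pairs. -/
theorem prod_abs_minorDet_le (M : ℕ → Matrix (Fin m) (Fin m) ℝ) (hM : ∀ j, (M j).rank ≤ k)
    {K : ℝ} (hK : ∀ j, |minorDet U Z (M j)| ≤ K) (n : ℕ) :
    ∏ j ∈ Finset.range (n + 1), |minorDet U Z (M (j + 1) * M j)|
      ≤ K ^ n * |minorDet U Z (matProd M (n + 2))| := by
  induction n with
  | zero => simp [matProd]
  | succ n ih =>
    have hK0 : 0 ≤ K := (abs_nonneg _).trans (hK 0)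
    have key := minorDet_mul_mul U Z (M (n + 2)) (M (n + 1)) (matProd M (n + 1)) (hM _)
    have key' := congrArg abs key
    rw [abs_mul, abs_mul] at key'
    rw [Finset.prod_range_succ]
    calc _ ≤ (K ^ n * |minorDet U Z (matProd M (n + 2))|)
            * |minorDet U Z (M (n + 1 + 1) * M (n + 1))| := by gcongr
      _ = K ^ n * (|minorDet U Z (M (n + 2) * M (n + 1))|
            * |minorDet U Z (M (n + 1) * matProd M (n + 1))|) := by
          simp only [matProd]; ring
      _ = K ^ n * (|minorDet U Z (matProd M (n + 3))| * |minorDet U Z (M (n + 1))|) := by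
          rw [← key']; simp only [matProd]
      _ ≤ K ^ n * (|minorDet U Z (matProd M (n + 3))| * K) := by gcongr; exact hK _
      _ = _ := by ring

end LinearAlgebra

/-! ### Functions and matrices with bounded holomorphic extension -/

/-- The algebra of complex functions on the torus that extend to bounded holomorphic functions on
the product of annuli. -/
def extAlgebra (d : ℕ) (r : ℝ) : Subalgebra ℂ (UnitAddTorus (Fin d) → ℂ) where
  carrier := {g | ∃ G : (Fin d → ℂ) → ℂ, DifferentiableOn ℂ G (polyannulus d r) ∧
    (∃ M, ∀ z ∈ polyannulus d r, ‖G z‖ ≤ M) ∧ ∀ x, G (torusEmb x) = g x}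
  mul_mem' := by
    rintro f g ⟨F, hF, ⟨M, hM⟩, hf⟩ ⟨G, hG, ⟨N, hN⟩, hg⟩
    refine ⟨F * G, hF.mul hG, ⟨M * N, fun z hz => ?_⟩, fun x => by simp [hf, hg]⟩
    rw [Pi.mul_apply, norm_mul]
    exact mul_le_mul (hM z hz) (hN z hz) (norm_nonneg _) ((norm_nonneg _).trans (hM z hz))
  add_mem' := by
    rintro f g ⟨F, hF, ⟨M, hM⟩, hf⟩ ⟨G, hG, ⟨N, hN⟩, hg⟩
    exact ⟨F + G, hF.add hG, ⟨M + N, fun z hz => norm_add_le_of_le (hM z hz) (hN z hz)⟩,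
      fun x => by simp [hf, hg]⟩
  algebraMap_mem' c := ⟨fun _ => c, differentiableOn_const _, ⟨‖c‖, fun _ _ => le_rfl⟩,
    fun _ => rfl⟩

section ExtAlgebra

variable {d : ℕ} {r : ℝ}

theorem continuous_of_mem_extAlgebra (hr : 0 < r) {g : UnitAddTorus (Fin d) → ℂ}
    (hg : g ∈ extAlgebra d r) : Continuous g := by
  obtain ⟨G, hG, -, h⟩ := hg
  rw [← funext h]
  exact hG.continuousOn.comp_continuous continuous_torusEmb fun x => torusEmb_mem hr x

/-- Translations of the torus extend to rotations of the product of annuli. -/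
theorem translate_mem_extAlgebra {g : UnitAddTorus (Fin d) → ℂ} (hg : g ∈ extAlgebra d r)
    (a : UnitAddTorus (Fin d)) : (fun x => g (x + a)) ∈ extAlgebra d r := by
  obtain ⟨G, hG, ⟨M, hM⟩, h⟩ := hg
  have hmaps : Set.MapsTo (fun z : Fin d → ℂ => fun i => z i * (AddCircle.toCircle (a i) : ℂ))
      (polyannulus d r) (polyannulus d r) := by
    intro z hz i
    have := hz i
    simp only [annulus, Set.mem_ofPred_eq, norm_mul, Circle.norm_coe, mul_one] at this ⊢
    exact this
  refine ⟨fun z => G fun i => z i * (AddCircle.toCircle (a i) : ℂ), hG.comp (by fun_prop) hmaps,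
    ⟨M, fun z hz => hM _ (hmaps hz)⟩, fun x => ?_⟩
  change G _ = g (x + a)
  rw [← h (x + a)]
  congr 1
  funext i
  simp [torusEmb, AddCircle.toCircle_add]

theorem lintegral_logNeg_sq_lt_top_of_mem_extAlgebra (hr : 0 < r) {g : UnitAddTorus (Fin d) → ℂ}
    (hg : g ∈ extAlgebra d r) {y : UnitAddTorus (Fin d)} (hy : g y ≠ 0) :
    ∫⁻ x, logNeg ‖g x‖ₑ ^ 2 < ∞ := by
  obtain ⟨G, hG, ⟨M, hM⟩, h⟩ := hg
  have hpos : 0 < max M 1 := lt_max_of_lt_right one_pos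
  have hne : ((max M 1 : ℝ) : ℂ) ≠ 0 := by exact_mod_cast hpos.ne'
  have key := lintegral_torus_logNeg_sq_lt_top hr d (fun z => G z * ((max M 1 : ℝ) : ℂ)⁻¹)
    (hG.mul_const _) (fun z hz => by
      rw [← div_eq_mul_inv, norm_div, Complex.norm_real, Real.norm_of_nonneg hpos.le, div_le_one hpos]
      exact (hM z hz).trans (le_max_left _ _)) y
    (mul_ne_zero (by rwa [h]) (inv_ne_zero hne))
  refine (lintegral_mono fun x => ?_).trans_lt key
  gcongr
  apply logNeg_anti
  rw [h, ← ofReal_norm, ← ofReal_norm]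
  apply ENNReal.ofReal_le_ofReal
  rw [← div_eq_mul_inv, norm_div, Complex.norm_real, Real.norm_of_nonneg hpos.le]
  exact div_le_self (norm_nonneg _) (le_max_right _ _)

/-- Matrix valued functions all of whose entries lie in `extAlgebra`. -/
def HasExt (r : ℝ) {k l : ℕ} (B : UnitAddTorus (Fin d) → Matrix (Fin k) (Fin l) ℝ) : Prop :=
  ∀ i j, (fun x => ((B x i j : ℝ) : ℂ)) ∈ extAlgebra d r

theorem hasExt_const {k l : ℕ} (M : Matrix (Fin k) (Fin l) ℝ) :
    HasExt (d := d) r fun _ => M := fun i j => (extAlgebra d r).algebraMap_mem (M i j : ℂ)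

theorem HasExt.mul {k l p : ℕ} {B : UnitAddTorus (Fin d) → Matrix (Fin k) (Fin l) ℝ}
    {D : UnitAddTorus (Fin d) → Matrix (Fin l) (Fin p) ℝ} (hB : HasExt r B) (hD : HasExt r D) :
    HasExt r fun x => B x * D x := by
  intro i j
  have : (fun x => (((B x * D x) i j : ℝ) : ℂ))
      = ∑ s, (fun x => ((B x i s : ℝ) : ℂ)) * fun x => ((D x s j : ℝ) : ℂ) := by
    funext x
    simp [Matrix.mul_apply]
  rw [this]
  exact sum_mem fun s _ => mul_mem (hB i s) (hD s j)

theorem HasExt.det {k : ℕ} {B : UnitAddTorus (Fin d) → Matrix (Fin k) (Fin k) ℝ}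
    (hB : HasExt r B) : (fun x => (((B x).det : ℝ) : ℂ)) ∈ extAlgebra d r := by
  have : (fun x => (((B x).det : ℝ) : ℂ)) = ∑ σ : Equiv.Perm (Fin k),
      ((Equiv.Perm.sign σ : ℤ) : ℂ) • ∏ i, fun x => ((B x (σ i) i : ℝ) : ℂ) := by
    funext x
    simp [Matrix.det_apply']
  rw [this]
  exact sum_mem fun σ _ => Subalgebra.smul_mem _ (prod_mem fun i _ => hB _ _) _

theorem HasExt.continuous (hr : 0 < r) {k l : ℕ}
    {B : UnitAddTorus (Fin d) → Matrix (Fin k) (Fin l) ℝ} (hB : HasExt r B) : Continuous B := by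
  refine continuous_matrix fun i j => ?_
  exact Complex.continuous_re.comp (continuous_of_mem_extAlgebra hr (hB i j))

theorem isBounded_polyannulus : Bornology.IsBounded (polyannulus d r) := by
  refine (Metric.isBounded_closedBall (x := (0 : Fin d → ℂ)) (r := |1 + r|)).subset fun z hz => ?_
  rw [mem_closedBall_zero_iff, pi_norm_le_iff_of_nonneg (abs_nonneg _)]
  exact fun i => (hz i).2.le.trans (le_abs_self _)

theorem hasExt_of_mem_analyticCocycles {m : ℕ}
    {A : UnitAddTorus (Fin d) → Matrix (Fin m) (Fin m) ℝ} (hA : A ∈ analyticCocycles d m r) :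
    HasExt r A := by
  obtain ⟨F, hd, hc, h⟩ := hA
  intro i j
  obtain ⟨M, hM⟩ := isBounded_polyannulus.isCompact_closure.exists_bound_of_continuousOn (hc i j)
  exact ⟨fun z => F z i j, hd i j, ⟨M, fun z hz => hM z (subset_closure hz)⟩,
    fun x => by simp [h]⟩

variable {m : ℕ} {A : UnitAddTorus (Fin d) → Matrix (Fin m) (Fin m) ℝ}

theorem HasExt.iter (hA : HasExt r A) (ω : UnitAddTorus (Fin d)) (n : ℕ) :
    HasExt r (iter ω A n) := by
  induction n with
  | zero => exact hasExt_const 1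
  | succ n ih =>
    have : HasExt r fun x => A (x + n • ω) := fun i j => translate_mem_extAlgebra (hA i j) _
    exact this.mul ih

end ExtAlgebra

theorem iter_add {d m : ℕ} (ω : UnitAddTorus (Fin d))
    (A : UnitAddTorus (Fin d) → Matrix (Fin m) (Fin m) ℝ) (a b : ℕ) (x : UnitAddTorus (Fin d)) :
    iter ω A (a + b) x = iter ω A a (x + b • ω) * iter ω A b x := by
  induction a with
  | zero => simp [iter]
  | succ a ih =>
    rw [Nat.succ_add]
    change A (x + (a + b) • ω) * iter ω A (a + b) x
      = A (x + b • ω + a • ω) * iter ω A a (x + b • ω) * iter ω A b x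
    rw [ih, Matrix.mul_assoc, add_comm a b, add_nsmul, add_assoc]

theorem matProd_iter {d m : ℕ} (ω : UnitAddTorus (Fin d))
    (A : UnitAddTorus (Fin d) → Matrix (Fin m) (Fin m) ℝ) (N n : ℕ) (x : UnitAddTorus (Fin d)) :
    matProd (fun j => iter ω A N (x + (j * N) • ω)) n = iter ω A (n * N) x := by
  induction n with
  | zero => simp [matProd, iter]
  | succ n ih => rw [matProd, ih, ← iter_add, Nat.succ_mul, add_comm]

theorem iter_mul_iter {d m : ℕ} (ω : UnitAddTorus (Fin d))
    (A : UnitAddTorus (Fin d) → Matrix (Fin m) (Fin m) ℝ) (N j : ℕ) (x : UnitAddTorus (Fin d)) :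
    iter ω A N (x + ((j + 1) * N) • ω) * iter ω A N (x + (j * N) • ω)
      = iter ω A (N + N) (x + (j * N) • ω) := by
  rw [iter_add, Nat.succ_mul, add_nsmul, add_assoc]

/-! ### The uniform square integrability of positive rank cocycles -/

instance isProbabilityMeasure_unitAddCircle :
    IsProbabilityMeasure (volume : Measure UnitAddCircle) :=
  ⟨by simp⟩

section Bounds

open scoped Matrix.Norms.L2Operator

variable {d m : ℕ} {r : ℝ} {A : UnitAddTorus (Fin d) → Matrix (Fin m) (Fin m) ℝ}

theorem l2_opNorm_one_le : ‖(1 : Matrix (Fin m) (Fin m) ℝ)‖ ≤ 1 := by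
  rw [Matrix.cstar_norm_def, map_one]
  exact ContinuousLinearMap.norm_id_le

theorem exists_norm_iter_le (hA : Continuous A) (ω : UnitAddTorus (Fin d)) :
    ∃ L : ℝ, 1 ≤ L ∧ ∀ n x, ‖iter ω A n x‖ ≤ L ^ n := by
  obtain ⟨C, hC⟩ := isCompact_univ.exists_bound_of_continuousOn hA.continuousOn
  refine ⟨max C 1, le_max_right _ _, fun n => ?_⟩
  induction n with
  | zero => intro x; simpa [iter] using l2_opNorm_one_le
  | succ n ih =>
    intro x
    rw [pow_succ']
    exact (norm_mul_le _ _).trans (mul_le_mul ((hC _ trivial).trans (le_max_left _ _)) (ih x)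
      (norm_nonneg _) (by positivity))

theorem exists_geomRank_iter_eq (ω : UnitAddTorus (Fin d))
    (A : UnitAddTorus (Fin d) → Matrix (Fin m) (Fin m) ℝ) :
    ∃ N ≥ 1, ∀ n ≥ N, geomRank (iter ω A n) = rank ω A := by
  have h := tendsto_rank ω A
  rw [nhds_discrete, tendsto_pure, eventually_atTop] at h
  obtain ⟨N, hN⟩ := h
  exact ⟨N + 1, by omega, fun n hn => hN n (by omega)⟩

/-- If `A` has positive rank `k`, let `N` be so large that `A⁽ᴺ⁾` and `A⁽²ᴺ⁾` have rank `k`, and let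
`g` be a compression determinant of `A⁽²ᴺ⁾` of size `k` that does not vanish identically. Since all
blocks `A⁽ᴺ⁾(T^{jN} x)` have rank at most `k`, the Birkhoff sums of `log⁻ |g|` over `T^N` dominate
`log⁻ ‖A⁽ⁿ⁾‖` up to a linear term. -/
theorem exists_logNeg_iter_le (hr : 0 < r) (hA : HasExt r A) (ω : UnitAddTorus (Fin d))
    (hk : 1 ≤ rank ω A) :
    ∃ g ∈ extAlgebra d r, (∃ y, g y ≠ 0) ∧ ∃ (N : ℕ) (b : ℝ≥0), ∀ n ≥ 1, ∀ x,
      logNeg ‖iter ω A n x‖ₑ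
        ≤ n * b + ∑ j ∈ Finset.range n, logNeg ‖g (x + (j * N) • ω)‖ₑ := by
  obtain ⟨N, hN1, hN⟩ := exists_geomRank_iter_eq ω A
  obtain ⟨y, hy⟩ := (isGreatest_geomRank (iter ω A (N + N))).1
  simp only [hN (N + N) (by omega)] at hy
  set k := rank ω A with hkdef
  obtain ⟨U, Z, hUZ⟩ : ∃ (U : Matrix (Fin k) (Fin m) ℝ) (Z : Matrix (Fin m) (Fin k) ℝ),
      U * iter ω A (N + N) y * Z = 1 := by
    rw [← hy]
    obtain ⟨-, Z, -, U, -, h⟩ := exists_rank_factorization (iter ω A (N + N) y)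
    exact ⟨U, Z, h⟩
  have hrank : ∀ x, (iter ω A N x).rank ≤ k := fun x => by
    rw [← hN N le_rfl]
    exact (isGreatest_geomRank (iter ω A N)).2 ⟨x, rfl⟩
  obtain ⟨L, hL1, hL⟩ := exists_norm_iter_le (hA.continuous hr) ω
  obtain ⟨C, hC1, hC⟩ := exists_abs_minorDet_le U Z hk
  obtain ⟨K₀, hK₀⟩ := isCompact_univ.exists_bound_of_continuousOn
    ((continuous_minorDet U Z).comp ((hA.iter ω N).continuous hr)).continuousOn
  set K := max K₀ 1 with hKdef
  have hK1 : 1 ≤ K := le_max_right _ _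
  have hK : ∀ x, |minorDet U Z (iter ω A N x)| ≤ K := fun x =>
    (hK₀ x trivial).trans (le_max_left _ _)
  -- `(n + 1) N ≤ 2 N n` for `n ≥ 1`, hence the exponent `2 N` for the growth of `n + 1` blocks.
  set B : ℝ := K * C * L ^ (2 * N) with hB
  have hB0 : 0 < B := by positivity
  have hg : (fun x => ((minorDet U Z (iter ω A (N + N) x) : ℝ) : ℂ)) ∈ extAlgebra d r :=
    (((hasExt_const U).mul (hA.iter ω (N + N))).mul (hasExt_const Z)).det
  refine ⟨_, hg, ⟨y, by simp [minorDet, hUZ]⟩, N, (logNeg (ENNReal.ofReal B⁻¹)).toNNReal, ?_⟩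
  intro n hn x
  obtain ⟨p, rfl⟩ : ∃ p, n = p + 1 := ⟨n - 1, by omega⟩
  rw [ENNReal.coe_toNNReal (logNeg_ne_top (by simpa using hB0))]
  set a := ‖iter ω A (p + 1) x‖ with ha
  -- The product of `p + 2` blocks of length `N` contains `A⁽ᵖ⁺¹⁾(x)` as its rightmost factor.
  set Q := iter ω A ((p + 2) * N) x with hQ
  have hprod := prod_abs_minorDet_le U Z (fun j => iter ω A N (x + (j * N) • ω))
    (fun j => hrank _) (fun j => hK _) p
  simp only [matProd_iter, iter_mul_iter] at hprod
  have hle : p + 1 ≤ (p + 2) * N := by nlinarith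
  have hQa : ‖Q‖ ≤ L ^ (2 * N * (p + 1)) * a := by
    obtain ⟨e, he⟩ := Nat.exists_eq_add_of_le' hle
    have he' : e ≤ 2 * N * (p + 1) := by nlinarith
    rw [hQ, he, iter_add]
    refine (norm_mul_le _ _).trans ?_
    gcongr
    exact (hL _ _).trans (pow_le_pow_right₀ hL1 he')
  have hBpow : B ^ (p + 1) = K ^ (p + 1) * C ^ (p + 1) * L ^ (2 * N * (p + 1)) := by
    rw [hB, mul_pow, mul_pow, ← pow_mul]
  have hmain : logNeg (ENNReal.ofReal (B ^ (p + 1) * a)) ≤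
      ∑ j ∈ Finset.range (p + 1),
        logNeg ‖((minorDet U Z (iter ω A (N + N) (x + (j * N) • ω)) : ℝ) : ℂ)‖ₑ := by
    -- The bound of `|D Q|` by `‖Q‖` needs `‖Q‖ ≤ 1`; otherwise `B ^ n * a ≥ 1` and `log⁻` vanishes.
    rcases le_total ‖Q‖ 1 with hQ1 | hQ1
    · refine le_trans (logNeg_anti ?_) (logNeg_prod_le _ _)
      have e1 : ∀ j, ‖((minorDet U Z (iter ω A (N + N) (x + (j * N) • ω)) : ℝ) : ℂ)‖ₑ
          = ENNReal.ofReal |minorDet U Z (iter ω A (N + N) (x + (j * N) • ω))| := fun j => by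
        rw [← ofReal_norm, Complex.norm_real, Real.norm_eq_abs]
      simp only [e1]
      rw [← ENNReal.ofReal_prod_of_nonneg fun _ _ => abs_nonneg _]
      apply ENNReal.ofReal_le_ofReal
      refine hprod.trans ?_
      calc K ^ p * |minorDet U Z Q| ≤ K ^ (p + 1) * (C ^ (p + 1) * (L ^ (2 * N * (p + 1)) * a)) := by
            gcongr
            · omega
            · refine (hC Q hQ1).trans ?_
              gcongr
              exact le_self_pow₀ hC1 (by omega)
        _ = B ^ (p + 1) * a := by rw [hBpow]; ring
    · rw [logNeg_of_one_le]
      · exact zero_le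
      · rw [ENNReal.one_le_ofReal, hBpow]
        have h1 : 1 ≤ K ^ (p + 1) * C ^ (p + 1) :=
          one_le_mul_of_one_le_of_one_le (one_le_pow₀ hK1) (one_le_pow₀ hC1)
        have h2 : 1 ≤ L ^ (2 * N * (p + 1)) * a := hQ1.trans hQa
        calc (1 : ℝ) ≤ (K ^ (p + 1) * C ^ (p + 1)) * (L ^ (2 * N * (p + 1)) * a) :=
              one_le_mul_of_one_le_of_one_le h1 h2
          _ = _ := by ring
  have hsplit : ‖iter ω A (p + 1) x‖ₑ
      = ENNReal.ofReal B⁻¹ ^ (p + 1) * ENNReal.ofReal (B ^ (p + 1) * a) := by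
    rw [← ENNReal.ofReal_pow (by positivity), ← ENNReal.ofReal_mul (by positivity), ← mul_assoc,
      ← mul_pow, inv_mul_cancel₀ hB0.ne', one_pow, one_mul, ha, ofReal_norm]
  rw [hsplit]
  exact (logNeg_mul_le _ _).trans (add_le_add (logNeg_pow_le _ _) hmain)

/-- `|log a| / n` is at most the sum of the negative and positive parts of `log a`, divided by `n`;
for `a = 0` both sides are infinite. -/
theorem abs_log_div_le {a : ℝ≥0∞} (ha : a ≠ ∞) {n : ℕ} (hn : 1 ≤ n) :
    (ENNReal.log a / (n : EReal)).abs ≤ ((n : ℝ≥0)⁻¹ : ℝ≥0) * (logNeg a + logNeg a⁻¹) := by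
  have hn0 : (0 : ℝ) < n := by exact_mod_cast hn
  have hinv : (((n : ℝ≥0)⁻¹ : ℝ≥0) : ℝ≥0∞) = ENNReal.ofReal ((n : ℝ)⁻¹) := by
    rw [ENNReal.ofReal]
    congr 1
    rw [Real.toNNReal_inv, Real.toNNReal_natCast]
  rcases eq_or_ne a 0 with rfl | h0
  · have : ((n : ℝ≥0)⁻¹ : ℝ≥0) ≠ 0 := by simp; omega
    simp only [logNeg_zero, top_add]
    rw [ENNReal.mul_top (by simpa using this)]
    exact le_top
  lift a to ℝ≥0 using ha
  have hpos : (0 : ℝ) < a := by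
    have : a ≠ 0 := by simpa using h0
    positivity
  have ha' : (a : ℝ≥0∞) = ENNReal.ofReal a := (ENNReal.ofReal_coe_nnreal).symm
  have hcast : (n : EReal) = ((n : ℝ) : EReal) := rfl
  rw [ha', ← ENNReal.ofReal_inv_of_pos hpos, logNeg_ofReal hpos, logNeg_ofReal (by positivity),
    ENNReal.log_ofReal_of_pos hpos, hcast, ← EReal.coe_div, EReal.abs_def, Real.log_inv, neg_neg,
    hinv, abs_div, abs_of_pos hn0, div_eq_inv_mul, ENNReal.ofReal_mul (by positivity)]
  gcongr
  rcases le_total 0 (Real.log a) with h | h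
  · rw [abs_of_nonneg h]; exact le_add_self
  · rw [abs_of_nonpos h]; exact le_self_add

theorem eLpNorm_const_add_sum_le {α : Type*} [MeasurableSpace α] {μ : Measure α}
    [IsProbabilityMeasure μ] {f : ℕ → α → ℝ≥0∞} (hf : ∀ j, Measurable (f j)) {c H : ℝ≥0∞}
    (hH : ∀ j, eLpNorm (f j) 2 μ ≤ H) (n : ℕ) :
    eLpNorm (fun x => c + ∑ j ∈ Finset.range n, f j x) 2 μ ≤ c + n * H := by
  induction n with
  | zero =>
    simp only [Finset.range_zero, Finset.sum_empty, add_zero]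
    rw [eLpNorm_const' _ (by simp) (by simp)]
    simp
  | succ n ih =>
    have hm : Measurable fun x => c + ∑ j ∈ Finset.range n, f j x :=
      measurable_const.add (Finset.measurable_fun_sum _ fun j _ => hf j)
    have h := eLpNorm_add_le (p := 2) hm.aestronglyMeasurable (hf n).aestronglyMeasurable
      (μ := μ) (by simp)
    have e : (fun x => c + ∑ j ∈ Finset.range (n + 1), f j x)
        = (fun x => c + ∑ j ∈ Finset.range n, f j x) + f n := by
      funext x
      rw [Pi.add_apply, Finset.sum_range_succ, add_assoc]
    rw [e]
    refine h.trans ((add_le_add ih (hH n)).trans (le_of_eq ?_))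
    push_cast
    ring

theorem eLpNorm_translate {f : UnitAddTorus (Fin d) → ℝ≥0∞} (hf : Measurable f)
    (a : UnitAddTorus (Fin d)) :
    eLpNorm (fun x => f (x + a)) 2 volume = eLpNorm f 2 volume :=
  eLpNorm_comp_measurePreserving (f := fun x => x + a) hf.aestronglyMeasurable
    (measurePreserving_add_right volume a)

/-- The uniform `L²` bound for cocycles of positive rank: translations preserve the measure, so
the Birkhoff sum of `n` terms has `L²` norm at most `n` times that of a single term. -/
theorem exists_eLpNorm_logNorm_le (hr : 0 < r) (hA : HasExt r A) (ω : UnitAddTorus (Fin d))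
    (hk : 1 ≤ rank ω A) :
    ∃ C : ℝ≥0, ∀ n ≥ 1, eLpNorm (fun x => (logNorm ω A n x).abs) 2 volume ≤ (C : ℝ≥0∞) := by
  obtain ⟨g, hg, ⟨y, hy⟩, N, b, hb⟩ := exists_logNeg_iter_le hr hA ω hk
  obtain ⟨L, hL1, hL⟩ := exists_norm_iter_le (hA.continuous hr) ω
  have hgc := continuous_of_mem_extAlgebra hr hg
  have hgm : Measurable fun x => logNeg ‖g x‖ₑ := measurable_logNeg.comp hgc.measurable.enorm
  set H := eLpNorm (fun x => logNeg ‖g x‖ₑ) 2 volume with hH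
  have hHtop : H ≠ ∞ := by
    have := lintegral_logNeg_sq_lt_top_of_mem_extAlgebra hr hg hy
    rw [← eLpNorm_two_sq] at this
    intro h
    rw [← hH, h] at this
    simp at this
  set c := (logNeg (ENNReal.ofReal L⁻¹)).toNNReal with hc
  have hc' : (c : ℝ≥0∞) = logNeg (ENNReal.ofReal L⁻¹) :=
    ENNReal.coe_toNNReal (logNeg_ne_top (by simp; linarith))
  refine ⟨b + c + H.toNNReal, fun n hn => ?_⟩
  push_cast
  rw [ENNReal.coe_toNNReal hHtop]
  have hn0 : (n : ℝ≥0∞) ≠ 0 := by simp; omega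
  have hinv : (((n : ℝ≥0)⁻¹ : ℝ≥0) : ℝ≥0∞) = (n : ℝ≥0∞)⁻¹ := by
    rw [ENNReal.coe_inv (by simp; omega)]; simp
  have hlow : ∀ x, logNeg (‖iter ω A n x‖ₑ)⁻¹ ≤ n * c := by
    intro x
    rw [hc']
    refine le_trans (logNeg_anti ?_) (logNeg_pow_le _ _)
    rw [ENNReal.ofReal_inv_of_pos (by linarith), ← ENNReal.inv_pow, ENNReal.inv_le_inv,
      ← ENNReal.ofReal_pow (by linarith), ← ofReal_norm]
    exact ENNReal.ofReal_le_ofReal (hL n x)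
  set S : UnitAddTorus (Fin d) → ℝ≥0∞ := fun x =>
    n * (b + c : ℝ≥0∞) + ∑ j ∈ Finset.range n, logNeg ‖g (x + (j * N) • ω)‖ₑ with hS
  have hSle : eLpNorm S 2 volume ≤ n * (b + c + H) := by
    rw [mul_add]
    exact eLpNorm_const_add_sum_le (f := fun j x => logNeg ‖g (x + (j * N) • ω)‖ₑ)
      (fun j => hgm.comp (measurable_add_const _)) (fun j => (eLpNorm_translate hgm _).le) n
  have hpt : ∀ x, (logNorm ω A n x).abs ≤ ((n : ℝ≥0)⁻¹ : ℝ≥0) * S x := by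
    intro x
    refine (abs_log_div_le enorm_ne_top hn).trans ?_
    gcongr
    refine (add_le_add (hb n hn x) (hlow x)).trans (le_of_eq ?_)
    simp only [hS]
    ring
  refine (eLpNorm_le_nnreal_smul_eLpNorm_of_ae_le_mul' (g := S) (c := (n : ℝ≥0)⁻¹)
    (Eventually.of_forall fun x => by simpa using hpt x) 2).trans ?_
  rw [ENNReal.smul_def, smul_eq_mul, hinv]
  refine (mul_le_mul_right hSle _).trans ?_
  rw [← mul_assoc, ENNReal.inv_mul_cancel hn0 (by simp), one_mul]

end Bounds

/-! ### The top Lyapunov exponent -/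

section Exponent

open scoped Matrix.Norms.L2Operator

variable {d m : ℕ} {r : ℝ} {A : UnitAddTorus (Fin d) → Matrix (Fin m) (Fin m) ℝ}

theorem logNorm_of_eq_zero {ω : UnitAddTorus (Fin d)} {n : ℕ} (hn : 1 ≤ n)
    {x : UnitAddTorus (Fin d)} (h : iter ω A n x = 0) : logNorm ω A n x = ⊥ := by
  have hn0 : (0 : EReal) < n := by exact_mod_cast hn
  rw [logNorm, h, enorm_zero, ENNReal.log_zero]
  exact EReal.bot_div_of_pos_ne_top hn0 (EReal.natCast_ne_top n)

theorem logNorm_of_ne_zero {ω : UnitAddTorus (Fin d)} {n : ℕ}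
    {x : UnitAddTorus (Fin d)} (h : iter ω A n x ≠ 0) :
    logNorm ω A n x = ((Real.log ‖iter ω A n x‖ / n : ℝ) : EReal) := by
  rw [logNorm, ← ofReal_norm, ENNReal.log_ofReal_of_pos (norm_pos_iff.2 h), EReal.coe_div]
  rfl

/-- A cocycle with an iterate that vanishes identically has exponent `-∞` at all later scales. -/
theorem finiteScaleExponent_eq_bot {ω : UnitAddTorus (Fin d)} {n : ℕ} (hn : 1 ≤ n)
    (h : ∀ x, iter ω A n x = 0) : finiteScaleExponent ω A n = ⊥ := by
  have h1 : ∀ x, logNorm ω A n x = ⊥ := fun x => logNorm_of_eq_zero hn (h x)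
  simp [finiteScaleExponent, extIntegral, h1]

theorem tendsto_finiteScaleExponent_bot {ω : UnitAddTorus (Fin d)} (h : IsNilpotent ω A) :
    Tendsto (finiteScaleExponent ω A) atTop (𝓝 ⊥) := by
  obtain ⟨n, hn, h0⟩ := h
  refine tendsto_const_nhds.congr' ?_
  filter_upwards [eventually_ge_atTop n] with p hp
  obtain ⟨e, rfl⟩ := Nat.exists_eq_add_of_le' hp
  exact (finiteScaleExponent_eq_bot (by omega) fun x => by rw [iter_add, h0, mul_zero]).symm

theorem rank_eq_zero_iff_isNilpotent (ω : UnitAddTorus (Fin d))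
    (A : UnitAddTorus (Fin d) → Matrix (Fin m) (Fin m) ℝ) :
    rank ω A = 0 ↔ IsNilpotent ω A := by
  constructor
  · intro h
    obtain ⟨N, hN1, hN⟩ := exists_geomRank_iter_eq ω A
    refine ⟨N, hN1, fun x => ?_⟩
    have h1 : (iter ω A N x).rank ≤ 0 := by
      rw [← h, ← hN N le_rfl]
      exact (isGreatest_geomRank (iter ω A N)).2 ⟨x, rfl⟩
    obtain ⟨X, -, Y, -, hXY, -⟩ := exists_rank_factorization (iter ω A N x)
    have : IsEmpty (Fin (iter ω A N x).rank) := by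
      rw [Nat.le_zero.1 h1]; infer_instance
    ext i j
    rw [hXY, Matrix.mul_apply, Finset.univ_eq_empty, Finset.sum_empty, Matrix.zero_apply]
  · rintro ⟨n, -, h⟩
    refine Nat.le_zero.1 (((antitone_geomRank ω A).le_of_tendsto (tendsto_rank ω A) n).trans ?_)
    refine ciSup_le fun x => ?_
    rw [h x, Matrix.rank_zero]

/-- Since `log 0 = -∞`, the `L²` bound forces the iterates to be nonzero almost everywhere. -/
theorem ae_iter_ne_zero (hr : 0 < r) (hA : HasExt r A) (ω : UnitAddTorus (Fin d))
    (hk : 1 ≤ rank ω A) (n : ℕ) : ∀ᵐ x, iter ω A n x ≠ 0 := by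
  suffices h : ∀ p ≥ 1, ∀ᵐ x, iter ω A p x ≠ 0 by
    filter_upwards [h (1 + n) (by omega)] with x hx h0
    rw [iter_add, h0, mul_zero] at hx
    exact hx rfl
  intro p hp
  obtain ⟨C, hC⟩ := exists_eLpNorm_logNorm_le hr hA ω hk
  have hZ : MeasurableSet {x | iter ω A p x = 0} :=
    (isClosed_singleton.preimage ((hA.iter ω p).continuous hr)).measurableSet
  have hle : ∞ * volume {x | iter ω A p x = 0} ≤ (C : ℝ≥0∞) ^ 2 := by
    calc ∞ * volume {x | iter ω A p x = 0}
        = ∫⁻ x in {x | iter ω A p x = 0}, ∞ := by rw [setLIntegral_const]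
      _ ≤ ∫⁻ x in {x | iter ω A p x = 0}, (logNorm ω A p x).abs ^ 2 :=
          setLIntegral_mono' hZ fun x hx => by rw [logNorm_of_eq_zero hp hx]; simp
      _ ≤ ∫⁻ x, (logNorm ω A p x).abs ^ 2 := setLIntegral_le_lintegral _ _
      _ ≤ (C : ℝ≥0∞) ^ 2 := by
          rw [← eLpNorm_two_sq]
          gcongr
          exact hC p hp
  rw [ae_iff]
  simp only [ne_eq, not_not]
  by_contra hne
  rw [ENNReal.top_mul hne, top_le_iff] at hle
  exact ENNReal.pow_ne_top ENNReal.coe_ne_top hle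

theorem measurable_log_norm_iter (hr : 0 < r) (hA : HasExt r A) (ω : UnitAddTorus (Fin d))
    (n : ℕ) : Measurable fun x => Real.log ‖iter ω A n x‖ :=
  Real.measurable_log.comp ((hA.iter ω n).continuous hr).norm.measurable

theorem exists_eLpNorm_log_norm_le (hr : 0 < r) (hA : HasExt r A) (ω : UnitAddTorus (Fin d))
    (hk : 1 ≤ rank ω A) :
    ∃ C : ℝ≥0, ∀ n ≥ 1, eLpNorm (fun x => Real.log ‖iter ω A n x‖ / n) 1 volume ≤ C := by
  obtain ⟨C, hC⟩ := exists_eLpNorm_logNorm_le hr hA ω hk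
  refine ⟨C, fun n hn => ?_⟩
  refine (eLpNorm_le_eLpNorm_of_exponent_le (μ := volume) (q := 2) (by simp)
    ((measurable_log_norm_iter hr hA ω n).div_const _).aestronglyMeasurable).trans
    (le_trans (eLpNorm_mono_enorm_ae ?_) (hC n hn))
  filter_upwards [ae_iter_ne_zero hr hA ω hk n] with x hx
  rw [logNorm_of_ne_zero hx, EReal.abs_def, enorm_eq_self, ← ofReal_norm, Real.norm_eq_abs]

theorem integrable_log_norm_iter (hr : 0 < r) (hA : HasExt r A) (ω : UnitAddTorus (Fin d))
    (hk : 1 ≤ rank ω A) (n : ℕ) : Integrable (fun x => Real.log ‖iter ω A n x‖) := by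
  rcases Nat.eq_zero_or_pos n with rfl | hn
  · simp only [iter]
    exact integrable_const (μ := (volume : Measure (UnitAddTorus (Fin d)))) _
  obtain ⟨C, hC⟩ := exists_eLpNorm_log_norm_le hr hA ω hk
  have h : Integrable (fun x => Real.log ‖iter ω A n x‖ / n) := memLp_one_iff_integrable.1
    ⟨((measurable_log_norm_iter hr hA ω n).div_const _).aestronglyMeasurable,
      (hC n hn).trans_lt ENNReal.coe_lt_top⟩
  refine (h.mul_const (n : ℝ)).congr (Eventually.of_forall fun x => ?_)
  have : (n : ℝ) ≠ 0 := by exact_mod_cast hn.ne'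
  simp only
  field_simp

theorem finiteScaleExponent_eq_integral (hr : 0 < r) (hA : HasExt r A) (ω : UnitAddTorus (Fin d))
    (hk : 1 ≤ rank ω A) (n : ℕ) :
    finiteScaleExponent ω A n = (((∫ x, Real.log ‖iter ω A n x‖) / n : ℝ) : EReal) := by
  set w : UnitAddTorus (Fin d) → ℝ := fun x => Real.log ‖iter ω A n x‖ / n with hw
  have hint : Integrable w := (integrable_log_norm_iter hr hA ω hk n).div_const _
  have hae : ∀ᵐ x, logNorm ω A n x = ((w x : ℝ) : EReal) := by
    filter_upwards [ae_iter_ne_zero hr hA ω hk n] with x hx using logNorm_of_ne_zero hx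
  have h1 : ∫⁻ x, (logNorm ω A n x).toENNReal = ∫⁻ x, ENNReal.ofReal (w x) :=
    lintegral_congr_ae (hae.mono fun x hx => by simp only [hx, EReal.real_coe_toENNReal])
  have h2 : ∫⁻ x, (-logNorm ω A n x).toENNReal = ∫⁻ x, ENNReal.ofReal (-w x) :=
    lintegral_congr_ae (hae.mono fun x hx => by
      simp only [hx, ← EReal.coe_neg, EReal.real_coe_toENNReal])
  have hp : ∫⁻ x, ENNReal.ofReal (w x) ≠ ∞ := hint.lintegral_lt_top.ne
  have hm : ∫⁻ x, ENNReal.ofReal (-w x) ≠ ∞ := hint.neg.lintegral_lt_top.ne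
  rw [finiteScaleExponent, extIntegral, h1, h2, ← integral_div,
    integral_eq_lintegral_pos_part_sub_lintegral_neg_part hint, EReal.coe_sub,
    EReal.coe_ennreal_toReal hp, EReal.coe_ennreal_toReal hm]

theorem subadditive_integral_log_norm_iter (hr : 0 < r) (hA : HasExt r A)
    (ω : UnitAddTorus (Fin d)) (hk : 1 ≤ rank ω A) :
    Subadditive fun n => ∫ x, Real.log ‖iter ω A n x‖ := by
  intro a b
  have hia := integrable_log_norm_iter hr hA ω hk a
  have hib := integrable_log_norm_iter hr hA ω hk b
  have hmp := measurePreserving_add_right (volume : Measure (UnitAddTorus (Fin d))) (b • ω)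
  have hia' : Integrable fun x => Real.log ‖iter ω A a (x + b • ω)‖ :=
    hmp.integrable_comp_of_integrable hia
  have hshift : ∫ x, Real.log ‖iter ω A a (x + b • ω)‖ = ∫ x, Real.log ‖iter ω A a x‖ :=
    integral_add_right_eq_self (fun x => Real.log ‖iter ω A a x‖) (b • ω)
  simp only
  rw [← hshift, ← integral_add hia' hib]
  refine integral_mono_ae (integrable_log_norm_iter hr hA ω hk (a + b)) (hia'.add hib) ?_
  filter_upwards [ae_iter_ne_zero hr hA ω hk (a + b)] with x hx
  have hx' := hx
  rw [iter_add] at hx'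
  have ha : iter ω A a (x + b • ω) ≠ 0 := left_ne_zero_of_mul hx'
  have hb : iter ω A b x ≠ 0 := right_ne_zero_of_mul hx'
  rw [← Real.log_mul (norm_ne_zero_iff.2 ha) (norm_ne_zero_iff.2 hb)]
  refine Real.log_le_log (norm_pos_iff.2 hx) ?_
  rw [iter_add]
  exact norm_mul_le _ _

/-- Fekete's lemma for cocycles of positive rank; the limit is finite by the uniform bound. -/
theorem exists_tendsto_finiteScaleExponent (hr : 0 < r) (hA : HasExt r A)
    (ω : UnitAddTorus (Fin d)) (hk : 1 ≤ rank ω A) :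
    ∃ l : ℝ, Tendsto (finiteScaleExponent ω A) atTop (𝓝 (l : EReal)) := by
  have hsub := subadditive_integral_log_norm_iter hr hA ω hk
  obtain ⟨C, hC⟩ := exists_eLpNorm_log_norm_le hr hA ω hk
  have hbdd : BddBelow (Set.range fun n : ℕ => (∫ x, Real.log ‖iter ω A n x‖) / n) := by
    refine ⟨-C, ?_⟩
    rintro _ ⟨n, rfl⟩
    rcases Nat.eq_zero_or_pos n with rfl | hn
    · simp
    simp only
    rw [← integral_div]
    have h1 := enorm_integral_le_lintegral_enorm
      (μ := volume) (fun x => Real.log ‖iter ω A n x‖ / n)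
    rw [← eLpNorm_one_eq_lintegral_enorm] at h1
    have h2 := h1.trans (hC n hn)
    rw [← ofReal_norm, ENNReal.ofReal_le_coe, Real.norm_eq_abs] at h2
    exact neg_le_of_abs_le h2
  refine ⟨hsub.lim, ?_⟩
  rw [funext (finiteScaleExponent_eq_integral hr hA ω hk)]
  exact (continuous_coe_real_ereal.tendsto _).comp (hsub.tendsto_lim hbdd)

end Exponent

end QPCocycle

end

theorem mainTheorem11 (d m : ℕ) (r : ℝ) (hr : 0 < r)
    (ω : UnitAddTorus (Fin d))
    (hω : Ergodic (fun x : UnitAddTorus (Fin d) => x + ω) volume)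
    (A : UnitAddTorus (Fin d) → Matrix (Fin m) (Fin m) ℝ)
    (hA : A ∈ QPCocycle.analyticCocycles d m r) :
    -- the limit that defines the top Lyapunov exponent exists
    Tendsto (QPCocycle.finiteScaleExponent ω A) atTop (𝓝 (QPCocycle.topExponent ω A)) ∧
    List.TFAE [QPCocycle.rank ω A = 0,
      QPCocycle.IsNilpotent ω A,
      QPCocycle.topExponent ω A = ⊥] ∧
    -- a cocycle of positive rank is bounded in `L²`, uniformly in the number of iterates
    (1 ≤ QPCocycle.rank ω A →
      ∃ C : ℝ≥0, ∀ n ≥ 1,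
        eLpNorm (fun x => (QPCocycle.logNorm ω A n x).abs) 2 volume ≤ (C : ℝ≥0∞)) := by
  have hext := QPCocycle.hasExt_of_mem_analyticCocycles hA
  have hiff := QPCocycle.rank_eq_zero_iff_isNilpotent ω A
  refine ⟨?_, ?_, QPCocycle.exists_eLpNorm_logNorm_le hr hext ω⟩
  · refine tendsto_nhds_limUnder ?_
    rcases Nat.eq_zero_or_pos (QPCocycle.rank ω A) with h | h
    · exact ⟨_, QPCocycle.tendsto_finiteScaleExponent_bot (hiff.1 h)⟩
    · obtain ⟨l, hl⟩ := QPCocycle.exists_tendsto_finiteScaleExponent hr hext ω h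
      exact ⟨_, hl⟩
  · tfae_have 1 ↔ 2 := hiff
    tfae_have 2 → 3 := fun h => (QPCocycle.tendsto_finiteScaleExponent_bot h).limUnder_eq
    tfae_have 3 → 1 := by
      intro h
      by_contra hne
      obtain ⟨l, hl⟩ := QPCocycle.exists_tendsto_finiteScaleExponent hr hext ω
        (Nat.one_le_iff_ne_zero.2 hne)
      rw [QPCocycle.topExponent, hl.limUnder_eq] at h
      exact EReal.coe_ne_bot l h
    tfae_finish
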